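/- All mixed graphs are finite. A simple mixed graph $G=(V_G,E_G,\vec E_G)$, with $n=|V_G|\ge 1$, consists of a vertex set, a set $E_G$ of edges (unordered pairs of distinct vertices) and a set $\vec E_G$ of arcs (ordered pairs of distinct vertices); an edge $uv$ and the arcs $(u,v)$, $(v,u)$ may be present together. A submixed graph of $G$ is a mixed graph whose vertices, edges and arcs belong to $G$. Write $d(v)$, $d^+(v)$, $d^-(v)$ for the number of edges at $v$, of arcs starting at $v$ and of arcs ending at $v$; $G_u$ for the graph $(V_G,E_G)$; $A$ for its adjacency matrix; and $\vec A$ for the matrix whose $(u,v)$ entry is $1$ if $(u,v)\in\vec E_G$ and $0$ otherwise. Let $\xi_1(G)$ be the largest eigenvalue of the integrated signless Laplacian matrix $$\begin{bmatrix} \operatorname{diag}(d(v)+d^+(v))+A & \vec A\\ \vec A^{T} & \operatorname{diag}(d(v)+d^-(v))+A\end{bmatrix}.$$ A walk of length $k$ is a sequence $v_0,e_0,v_1,\dots,e_{k-1},v_k$ in which each $e_i$ is the edge $\{v_i,v_{i+1}\}$, the arc $(v_i,v_{i+1})$ or the arc $(v_{i+1},v_i)$. In a mixed graph with at least one arc,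 a walk is alternating if its successive arcs, irrespective of the edges between them, are traversed alternately along and against their direction. An alternating path is an alternating walk such that (a) each vertex occurs at most twice, and if it occurs twice there is an odd number of arcs between the two occurrences; (b) each edge occurs at most twice, and if it occurs twice there is an odd number of arcs between the two occurrences; (c) no arc is repeated. An alternating cycle is an alternating walk that satisfies (b) and (c) and whose first and last vertices coincide. A mixed graph $S$ with at least one arc is special if any two distinct vertices of $S$ are joined by an alternating walk in $S$, and for each component $H$ of $S_u$ that contains both a vertex at which an arc of $S$ ends and a vertex at which an arc of $S$ starts, every vertex of $H$ is the start and the end of a closed alternating walk in $S$ with an odd number of arcs. A mixed component of $G$ is a submixed graph of $G$ that is (1) a component of $G_u$ all of whose vertices have out-degree $0$ in $G$, or (2) a component of $G_u$ all of whose vertices have in-degree $0$ in $G$, or (3) a maximal special submixed graph of $G$. Mixed components are counted as a multiset: a submixed graph that satisfies both (1) and (2) counts twice. $G$ is uniconnected if it has exactly one mixed component. A mixed component $H$ has the AP property if $H$ is an undirected path (possibly a single vertex), or $H$ has an alternating path that contains all arcs of $H$, contains each vertex $v$ of $H$ exactly twice if some alternating path in $H$ contains $v$ twice and exactly once otherwise,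 and contains each edge $e$ of $H$ exactly twice if some alternating path in $H$ contains $e$ twice and exactly once otherwise. Theorem. Let $G$ be a simple mixed graph on $n\ge1$ vertices. Then: (i) $\xi_1(G)=0$ if and only if $G$ has no edges and no arcs; (ii) $\xi_1(G)<4$ if and only if each mixed component of $G$ has the AP property; (iii) if $G$ is uniconnected, then $\xi_1(G)=4$ if and only if $G$ has an alternating cycle of length $2n$ with an even number of arcs that contains all the vertices, all the arcs, and each edge of $G$ exactly twice. -/

import Mathlib

/-- A simple mixed graph whose vertices lie in `V`: a set of vertices, a set of edges (unordered
pairs of vertices) and a set of arcs (ordered pairs of vertices), without loops and without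
directed loops. An edge `uv` and the arcs `u → v` and `v → u` may be present together. -/
@[ext] structure SimpleMixedGraph (V : Type*) where
  verts : Set V
  edges : Set (Sym2 V)
  arcs : Set (V × V)
  edge_mem : ∀ e ∈ edges, ∀ v ∈ e, v ∈ verts
  arc_mem : ∀ a ∈ arcs, a.1 ∈ verts ∧ a.2 ∈ verts
  edge_loopless : ∀ e ∈ edges, ¬ e.IsDiag
  arc_loopless : ∀ a ∈ arcs, a.1 ≠ a.2

namespace SimpleMixedGraph

variable {V : Type*}

/-! ### The integrated signless Laplacian matrix -/

/-- The undirected degree `d(v)`. -/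
noncomputable def degree (G : SimpleMixedGraph V) (v : V) : ℕ := {e | e ∈ G.edges ∧ v ∈ e}.ncard

/-- The out-degree `d⁺(v)`. -/
noncomputable def outDegree (G : SimpleMixedGraph V) (v : V) : ℕ := {w | (v, w) ∈ G.arcs}.ncard

/-- The in-degree `d⁻(v)`. -/
noncomputable def inDegree (G : SimpleMixedGraph V) (v : V) : ℕ := {w | (w, v) ∈ G.arcs}.ncard

open Classical in
/-- The adjacency matrix of the undirected part. -/
noncomputable def edgeMatrix (G : SimpleMixedGraph V) : Matrix G.verts G.verts ℝ :=
  Matrix.of fun u v => if s(u.1, v.1) ∈ G.edges then 1 else 0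

open Classical in
/-- The adjacency matrix of the directed part. -/
noncomputable def arcMatrix (G : SimpleMixedGraph V) : Matrix G.verts G.verts ℝ :=
  Matrix.of fun u v => if (u.1, v.1) ∈ G.arcs then 1 else 0

/-- The integrated adjacency matrix. The two summands of the index type are the two copies
`v'` and `v''` of the vertices. -/
noncomputable def integratedAdjacency (G : SimpleMixedGraph V) :
    Matrix (G.verts ⊕ G.verts) (G.verts ⊕ G.verts) ℝ :=
  Matrix.fromBlocks G.edgeMatrix G.arcMatrix G.arcMatrix.transpose G.edgeMatrix

open Classical in
/-- The integrated degree matrix. -/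
noncomputable def integratedDegree (G : SimpleMixedGraph V) :
    Matrix (G.verts ⊕ G.verts) (G.verts ⊕ G.verts) ℝ :=
  Matrix.diagonal (Sum.elim (fun v => ((G.degree v.1 + G.outDegree v.1 : ℕ) : ℝ))
    (fun v => ((G.degree v.1 + G.inDegree v.1 : ℕ) : ℝ)))

/-- The integrated signless Laplacian matrix. -/
noncomputable def signlessLaplacian (G : SimpleMixedGraph V) :
    Matrix (G.verts ⊕ G.verts) (G.verts ⊕ G.verts) ℝ :=
  G.integratedDegree + G.integratedAdjacency

open Classical in
theorem signlessLaplacian_isHermitian (G : SimpleMixedGraph V) :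
    G.signlessLaplacian.IsHermitian := by
  have hE : G.edgeMatrix.IsHermitian := by
    ext u v
    simp [edgeMatrix, Matrix.conjTranspose_apply, Sym2.eq_swap (a := v.1) (b := u.1)]
  refine Matrix.IsHermitian.add ?_ ?_
  · unfold integratedDegree
    exact Matrix.isHermitian_diagonal _
  · exact Matrix.IsHermitian.fromBlocks hE (by ext; simp) hE

open Classical in
/-- The largest eigenvalue `ξ₁(G)` of the integrated signless Laplacian matrix: the first entry
in the list of its eigenvalues in non-increasing order. -/
noncomputable def xiOne (G : SimpleMixedGraph V) [Fintype G.verts] [Nonempty G.verts] : ℝ :=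
  G.signlessLaplacian_isHermitian.eigenvalues₀ ⟨0, Fintype.card_pos⟩

/-! ### Walks -/

/-- A walk `v₀, e₀, v₁, e₁, …, v_k`, where each `eᵢ` is the edge `{vᵢ, vᵢ₊₁}`, the arc
`(vᵢ, vᵢ₊₁)` or the arc `(vᵢ₊₁, vᵢ)`. -/
structure Walk (G : SimpleMixedGraph V) where
  length : ℕ
  vert : Fin (length + 1) → V
  item : Fin length → Sym2 V ⊕ V × V
  vert_mem : ∀ i, vert i ∈ G.verts
  item_mem : ∀ i,
    (s(vert i.castSucc, vert i.succ) ∈ G.edges ∧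
      item i = Sum.inl s(vert i.castSucc, vert i.succ)) ∨
    ((vert i.castSucc, vert i.succ) ∈ G.arcs ∧
      item i = Sum.inr (vert i.castSucc, vert i.succ)) ∨
    ((vert i.succ, vert i.castSucc) ∈ G.arcs ∧
      item i = Sum.inr (vert i.succ, vert i.castSucc))

namespace Walk

variable {G : SimpleMixedGraph V}

def start (W : G.Walk) : V := W.vert 0

def finish (W : G.Walk) : V := W.vert (Fin.last W.length)

/-- The `i`-th step uses an arc. -/
def IsArcAt (W : G.Walk) (i : Fin W.length) : Prop := ∃ a, W.item i = Sum.inr a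

/-- The `i`-th step traverses an arc along its direction. -/
def IsForwardAt (W : G.Walk) (i : Fin W.length) : Prop :=
  W.item i = Sum.inr (W.vert i.castSucc, W.vert i.succ)

/-- The number of arcs in the walk, with repetitions. -/
noncomputable def arcCount (W : G.Walk) : ℕ := {k | W.IsArcAt k}.ncard

/-- The number of occurrences of the vertex `v` in the walk. -/
noncomputable def vertCount (W : G.Walk) (v : V) : ℕ := {i | W.vert i = v}.ncard

/-- The number of occurrences of the edge `e` in the walk. -/
noncomputable def edgeCount (W : G.Walk) (e : Sym2 V) : ℕ := {i | W.item i = Sum.inl e}.ncard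

/-- The number of occurrences of the arc `a` in the walk. -/
noncomputable def arcOccurrences (W : G.Walk) (a : V × V) : ℕ :=
  {i | W.item i = Sum.inr a}.ncard

/-- A walk, in a mixed graph with at least one arc, whose consecutive arcs are traversed in
alternating directions, irrespective of the edges between them. -/
def IsAlternating (W : G.Walk) : Prop :=
  G.arcs.Nonempty ∧
  ∀ i j : Fin W.length, i < j → W.IsArcAt i → W.IsArcAt j →
    (∀ k, i < k → k < j → ¬ W.IsArcAt k) → (W.IsForwardAt i ↔ ¬ W.IsForwardAt j)

/-- Each vertex occurs at most twice, and between two occurrences of a vertex there is an odd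
number of arcs. -/
def VertexCondition (W : G.Walk) : Prop :=
  (∀ v, W.vertCount v ≤ 2) ∧
  ∀ i j : Fin (W.length + 1), i < j → W.vert i = W.vert j →
    Odd {k : Fin W.length | i ≤ k.castSucc ∧ k.castSucc < j ∧ W.IsArcAt k}.ncard

/-- Each edge occurs at most twice, and between two occurrences of an edge there is an odd
number of arcs. -/
def EdgeCondition (W : G.Walk) : Prop :=
  (∀ e, W.edgeCount e ≤ 2) ∧
  ∀ (i j : Fin W.length) (e : Sym2 V), i < j → W.item i = Sum.inl e → W.item j = Sum.inl e →
    Odd {k : Fin W.length | i < k ∧ k < j ∧ W.IsArcAt k}.ncard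

/-- No arc is repeated. -/
def ArcCondition (W : G.Walk) : Prop := ∀ a, W.arcOccurrences a ≤ 1

def IsAlternatingPath (W : G.Walk) : Prop :=
  W.IsAlternating ∧ W.VertexCondition ∧ W.EdgeCondition ∧ W.ArcCondition

def IsAlternatingCycle (W : G.Walk) : Prop :=
  W.IsAlternating ∧ W.EdgeCondition ∧ W.ArcCondition ∧ W.start = W.finish

end Walk

/-! ### Submixed graphs and mixed components -/

/-- `H ≤ G` means that `H` is a submixed graph of `G`. -/
instance : LE (SimpleMixedGraph V) where
  le H G := H.verts ⊆ G.verts ∧ H.edges ⊆ G.edges ∧ H.arcs ⊆ G.arcs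

/-- The undirected part of `G`. -/
def undirectedPart (G : SimpleMixedGraph V) : SimpleMixedGraph V where
  verts := G.verts
  edges := G.edges
  arcs := ∅
  edge_mem := G.edge_mem
  arc_mem := by simp
  edge_loopless := G.edge_loopless
  arc_loopless := by simp

def Connected (G : SimpleMixedGraph V) : Prop :=
  G.verts.Nonempty ∧ ∀ u ∈ G.verts, ∀ v ∈ G.verts, ∃ W : G.Walk, W.start = u ∧ W.finish = v

/-- `H` is a (connected) component of `G`. -/
def IsComponent (H G : SimpleMixedGraph V) : Prop :=
  Maximal (fun C : SimpleMixedGraph V => C ≤ G ∧ C.Connected) H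

/-- The defining property of a special submixed graph. -/
def IsSpecial (G : SimpleMixedGraph V) : Prop :=
  G.arcs.Nonempty ∧
  (∀ u ∈ G.verts, ∀ v ∈ G.verts, u ≠ v →
    ∃ W : G.Walk, W.IsAlternating ∧ W.start = u ∧ W.finish = v) ∧
  ∀ H : SimpleMixedGraph V, H.IsComponent G.undirectedPart →
    (∃ v ∈ H.verts, ∃ u, (u, v) ∈ G.arcs) → (∃ v ∈ H.verts, ∃ u, (v, u) ∈ G.arcs) →
    ∀ v ∈ H.verts, ∃ W : G.Walk, W.IsAlternating ∧ W.start = v ∧ W.finish = v ∧ Odd W.arcCount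

/-- First kind of mixed component: a component of the undirected part all of whose vertices
have out-degree zero in `G`. -/
def IsOutFreeComponent (H G : SimpleMixedGraph V) : Prop :=
  H.IsComponent G.undirectedPart ∧ ∀ v ∈ H.verts, ∀ u, (v, u) ∉ G.arcs

/-- Second kind of mixed component: a component of the undirected part all of whose vertices
have in-degree zero in `G`. -/
def IsInFreeComponent (H G : SimpleMixedGraph V) : Prop :=
  H.IsComponent G.undirectedPart ∧ ∀ v ∈ H.verts, ∀ u, (u, v) ∉ G.arcs

/-- Third kind of mixed component: a maximal special submixed graph. -/
def IsMaximalSpecial (H G : SimpleMixedGraph V) : Prop :=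
  Maximal (fun C : SimpleMixedGraph V => C ≤ G ∧ C.IsSpecial) H

def IsMixedComponent (H G : SimpleMixedGraph V) : Prop :=
  H.IsOutFreeComponent G ∨ H.IsInFreeComponent G ∨ H.IsMaximalSpecial G

/-- The mixed components of `G` form a multiset: a submixed graph counts once for each of the
three conditions that it satisfies, so a component of the undirected part that meets no arc of
`G` counts twice. -/
def MixedComponents (G : SimpleMixedGraph V) : Type _ :=
  {H : SimpleMixedGraph V // H.IsOutFreeComponent G} ⊕
  {H : SimpleMixedGraph V // H.IsInFreeComponent G} ⊕
  {H : SimpleMixedGraph V // H.IsMaximalSpecial G}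

/-- `G` has exactly one mixed component. -/
def Uniconnected (G : SimpleMixedGraph V) : Prop := Nat.card G.MixedComponents = 1

/-! ### The associated path property -/

/-- The simple graph of the edges of `G` on its vertices. -/
def edgeGraph (G : SimpleMixedGraph V) : SimpleGraph G.verts where
  Adj u v := s(u.1, v.1) ∈ G.edges
  symm := ⟨fun u v h => by rwa [Sym2.eq_swap]⟩
  loopless := ⟨fun u h => G.edge_loopless _ h rfl⟩

/-- `G` is an undirected path on `m + 1` vertices for some `m`. -/
def IsPath (G : SimpleMixedGraph V) : Prop :=
  G.arcs = ∅ ∧ ∃ m : ℕ, Nonempty (SimpleGraph.pathGraph (m + 1) ≃g G.edgeGraph)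

/-- The vertices that some alternating path in `H` contains twice. -/
def twiceVerts (H : SimpleMixedGraph V) : Set V :=
  {v | v ∈ H.verts ∧ ∃ W : H.Walk, W.IsAlternatingPath ∧ W.vertCount v = 2}

/-- The edges that some alternating path in `H` contains twice. -/
def twiceEdges (H : SimpleMixedGraph V) : Set (Sym2 V) :=
  {e | e ∈ H.edges ∧ ∃ W : H.Walk, W.IsAlternatingPath ∧ W.edgeCount e = 2}

open Classical in
/-- The associated path property. -/
def HasAPProperty (H : SimpleMixedGraph V) : Prop :=
  H.IsPath ∨ ∃ W : H.Walk, W.IsAlternatingPath ∧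
    (∀ v ∈ H.verts, W.vertCount v = if v ∈ H.twiceVerts then 2 else 1) ∧
    (∀ a ∈ H.arcs, 1 ≤ W.arcOccurrences a) ∧
    (∀ e ∈ H.edges, W.edgeCount e = if e ∈ H.twiceEdges then 2 else 1)

end SimpleMixedGraph

/-! ### Rayleigh quotients of real symmetric matrices -/

namespace Matrix.IsHermitian

open Matrix

variable {ι : Type*} [Fintype ι]

/-! The integrated signless Laplacian is the signless Laplacian of an ordinary simple graph, the
associated graph `assoc`: every vertex `v` has two copies `(v, false)` and `(v, true)`, every edge
is repeated inside each copy, and an arc `(u, v)` becomes the single edge from `(u, false)` to `(v,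
true)` (`signlessLaplacian_eq`). The theorem thus splits into a spectral statement about ordinary
graphs and a dictionary between `G` and `assoc`.

Spectral side. The largest eigenvalue maximises a Rayleigh quotient whose numerator is a sum of `(x
u + x v) ^ 2` over adjacent pairs. It is at least 4 if some vertex has three neighbours
(`star_bound`) or some component has all degrees at least 2 (`four_le_of_closed`). If all degrees
are at most 2 it is at most 4, and equality makes an extremal vector constant on components and zero
at vertices of degree at most 1. So it is below 4 exactly when every component is a path
(`lt_four_iff`, `exists_isPathEnum_iff`). For a connected graph with no vertex adjacent to all the
others, it equals 4 exactly when the graph is 2-regular (`eq_four_iff`), that is, a cycle. The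
associated graph has no such vertex, since the two copies of a vertex are never adjacent.

Dictionary. Alternating walks are exactly the projections of walks of `assoc`. The bit of a lift
flips at arcs only, so an odd number of arcs between two occurrences of a vertex means that they lie
on different copies. Hence, when there are arcs, alternating paths are projected paths, and the edge
and arc conditions say that the lift is a trail. The components of `assoc` that meet an arc give the
maximal special submixed graphs, while the others are single copies of undirected components:
`false` copies for out-degree zero, `true` copies for in-degree zero. The AP property then says that
the component of `assoc` is a path, and in the uniconnected case the cycle in (iii) is a Hamiltonian
cycle of `assoc` that uses all its edges. -/

theorem exists_eq_eigenvalues₀ {A : Matrix ι ι ℝ} (hA : A.IsHermitian) [DecidableEq ι]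
    (k : Fin (Fintype.card ι)) : ∃ i, hA.eigenvalues i = hA.eigenvalues₀ k := by
  refine ⟨Fintype.equivOfCardEq (Fintype.card_fin _) k, ?_⟩
  simp [eigenvalues]

theorem exists_top_eigenvector {A : Matrix ι ι ℝ} (hA : A.IsHermitian)
    [DecidableEq ι] (h0 : 0 < Fintype.card ι) :
    ∃ x : ι → ℝ, x ≠ 0 ∧ x ⬝ᵥ A *ᵥ x = hA.eigenvalues₀ ⟨0, h0⟩ * (x ⬝ᵥ x) := by
  obtain ⟨i, hi⟩ := hA.exists_eq_eigenvalues₀ ⟨0, h0⟩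
  refine ⟨(hA.eigenvectorBasis i).ofLp, ?_, ?_⟩
  · intro h
    have := hA.eigenvectorBasis.orthonormal.ne_zero i
    exact this (by ext j; exact congrFun h j)
  · rw [hA.mulVec_eigenvectorBasis, hi, dotProduct_smul, smul_eq_mul]

/-- An eigenvector of `ξ • 1 - A` for `μ` is an eigenvector of `A` for `ξ - μ`. Since `ξ` is the
largest eigenvalue of `A`, `μ` is nonnegative, so `ξ • 1 - A` is positive semidefinite. -/
theorem dotProduct_mulVec_le_top {A : Matrix ι ι ℝ} (hA : A.IsHermitian)
    [DecidableEq ι] (h0 : 0 < Fintype.card ι) (x : ι → ℝ) :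
    x ⬝ᵥ A *ᵥ x ≤ hA.eigenvalues₀ ⟨0, h0⟩ * (x ⬝ᵥ x) := by
  set ξ := hA.eigenvalues₀ ⟨0, h0⟩ with hξ
  have hle : ∀ i, hA.eigenvalues i ≤ ξ := fun i => by
    unfold eigenvalues
    exact hA.eigenvalues₀_antitone (Fin.mk_le_of_le_val (Nat.zero_le _))
  have hB : (ξ • (1 : Matrix ι ι ℝ) - A).IsHermitian := by
    refine IsHermitian.sub ?_ hA
    simp [IsHermitian]
  have hps : (ξ • (1 : Matrix ι ι ℝ) - A).PosSemidef := by
    rw [hB.posSemidef_iff_eigenvalues_nonneg]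
    intro i
    have hv := hB.mulVec_eigenvectorBasis i
    set v := (hB.eigenvectorBasis i).ofLp with hvdef
    have hv0 : v ≠ 0 := fun h => hB.eigenvectorBasis.orthonormal.ne_zero i
      (by ext j; exact congrFun h j)
    have hAv : A *ᵥ v = (ξ - hB.eigenvalues i) • v := by
      rw [sub_mulVec, smul_mulVec, one_mulVec] at hv
      rw [sub_smul, ← hv]; abel
    have hmem : ξ - hB.eigenvalues i ∈ spectrum ℝ A := by
      rw [← Matrix.spectrum_toLin']
      refine Module.End.HasEigenvalue.mem_spectrum
        (Module.End.hasEigenvalue_of_hasEigenvector (x := v) ⟨?_, hv0⟩)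
      rw [Module.End.mem_eigenspace_iff, toLin'_apply, hAv]
    rw [hA.spectrum_real_eq_range_eigenvalues] at hmem
    obtain ⟨j, hj⟩ := hmem
    have := hle j
    simp only [Pi.zero_apply]
    linarith
  have := hps.dotProduct_mulVec_nonneg x
  rw [sub_mulVec, smul_mulVec, one_mulVec, dotProduct_sub, dotProduct_smul] at this
  simpa using this

end Matrix.IsHermitian

/-! ### The signless Laplacian of a simple graph and the value 4 -/

namespace SimpleGraph

variable {ι : Type*} [Fintype ι]

open Classical in
/-- Twice the quadratic form of the signless Laplacian of `K`. -/
noncomputable def signlessForm (K : SimpleGraph ι) (x : ι → ℝ) : ℝ :=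
  ∑ u, ∑ v, if K.Adj u v then (x u + x v) ^ 2 else 0

/-- `ξ` is the maximum of the Rayleigh quotient of the signless Laplacian of `K`. -/
def IsTopSignless (K : SimpleGraph ι) (ξ : ℝ) : Prop :=
  (∃ x : ι → ℝ, x ≠ 0 ∧ K.signlessForm x = 2 * ξ * ∑ u, x u ^ 2) ∧
  ∀ x : ι → ℝ, K.signlessForm x ≤ 2 * ξ * ∑ u, x u ^ 2

variable {K : SimpleGraph ι} {ξ : ℝ}

open Classical in
theorem sum_adj_sq_left (K : SimpleGraph ι) (x : ι → ℝ) :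
    ∑ u, ∑ v, (if K.Adj u v then x u ^ 2 else 0) = ∑ u, K.degree u * x u ^ 2 := by
  refine Finset.sum_congr rfl fun u _ => ?_
  rw [← Finset.sum_filter, Finset.sum_const, nsmul_eq_mul, ← card_neighborFinset_eq_degree,
    neighborFinset_eq_filter]

open Classical in
theorem sum_adj_sq_right (K : SimpleGraph ι) (x : ι → ℝ) :
    ∑ u, ∑ v, (if K.Adj u v then x v ^ 2 else 0) = ∑ u, K.degree u * x u ^ 2 := by
  rw [Finset.sum_comm, ← sum_adj_sq_left]
  simp [K.adj_comm]

open Classical in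
theorem signlessForm_eq_add (K : SimpleGraph ι) (x : ι → ℝ) :
    K.signlessForm x = 2 * ∑ u, K.degree u * x u ^ 2 +
      2 * ∑ u, ∑ v, if K.Adj u v then x u * x v else 0 := by
  rw [two_mul (∑ u, (K.degree u : ℝ) * x u ^ 2)]
  nth_rw 1 [← sum_adj_sq_left]
  rw [← sum_adj_sq_right, signlessForm]
  simp only [Finset.mul_sum, ← Finset.sum_add_distrib]
  refine Finset.sum_congr rfl fun u _ => Finset.sum_congr rfl fun v _ => ?_
  split_ifs <;> ring

open Classical in
-- This is `(a + b)² = 2a² + 2b² - (a - b)²` summed over adjacent pairs. The degree term gives the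
-- upper bound 4 when degrees are at most 2, and the subtracted term controls equality.
theorem signlessForm_eq (K : SimpleGraph ι) (x : ι → ℝ) :
    K.signlessForm x = 4 * ∑ u, K.degree u * x u ^ 2 -
      ∑ u, ∑ v, if K.Adj u v then (x u - x v) ^ 2 else 0 := by
  have h : (4 : ℝ) * ∑ u, K.degree u * x u ^ 2 = 2 * (∑ u, K.degree u * x u ^ 2) +
    (∑ u, K.degree u * x u ^ 2 + ∑ u, K.degree u * x u ^ 2) := by ring
  rw [h, signlessForm_eq_add, add_sub_assoc]
  congr 1
  nth_rw 1 [← sum_adj_sq_left]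
  rw [← sum_adj_sq_right]
  simp only [Finset.mul_sum, ← Finset.sum_add_distrib, ← Finset.sum_sub_distrib]
  refine Finset.sum_congr rfl fun u _ => Finset.sum_congr rfl fun v _ => ?_
  split_ifs <;> ring

open Classical in
/-- The top eigenvalue of the signless Laplacian matrix is the maximum of the Rayleigh quotient. -/
theorem isTopSignless_eigenvalues₀ (K : SimpleGraph ι) {Q : Matrix ι ι ℝ} (hQ : Q.IsHermitian)
    (h : Q = Matrix.diagonal (fun u => (K.degree u : ℝ)) + K.adjMatrix ℝ)
    (h0 : 0 < Fintype.card ι) : K.IsTopSignless (hQ.eigenvalues₀ ⟨0, h0⟩) := by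
  have hform : ∀ x : ι → ℝ, K.signlessForm x = 2 * (x ⬝ᵥ Q.mulVec x) := fun x => by
    rw [signlessForm_eq_add, h, Matrix.add_mulVec, dotProduct_add, mul_add]
    congr 2
    · simp only [dotProduct, Matrix.mulVec_diagonal]
      exact Finset.sum_congr rfl fun u _ => by ring
    · simp only [dotProduct, Matrix.mulVec, Finset.mul_sum]
      refine Finset.sum_congr rfl fun u _ => Finset.sum_congr rfl fun v _ => ?_
      simp [adjMatrix_apply]
  have hsq : ∀ x : ι → ℝ, x ⬝ᵥ x = ∑ u, x u ^ 2 := fun x => by simp [dotProduct, sq]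
  refine ⟨?_, fun x => ?_⟩
  · obtain ⟨x, hx, he⟩ := hQ.exists_top_eigenvector h0
    exact ⟨x, hx, by rw [hform, he, hsq, mul_assoc]⟩
  · have := hQ.dotProduct_mulVec_le_top h0 x
    rw [hform, mul_assoc, ← hsq]
    linarith

theorem sum_le_signlessForm (K : SimpleGraph ι) (x : ι → ℝ) (S : Finset (ι × ι))
    (hS : ∀ p ∈ S, K.Adj p.1 p.2) : ∑ p ∈ S, (x p.1 + x p.2) ^ 2 ≤ K.signlessForm x := by
  classical
  have h : K.signlessForm x = ∑ p : ι × ι, if K.Adj p.1 p.2 then (x p.1 + x p.2) ^ 2 else 0 := by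
    rw [Fintype.sum_prod_type]; unfold signlessForm; congr! 2
  rw [h]
  calc _ = ∑ p ∈ S, if K.Adj p.1 p.2 then (x p.1 + x p.2) ^ 2 else 0 :=
        Finset.sum_congr rfl fun p hp => by rw [if_pos (hS p hp)]
    _ ≤ _ := Finset.sum_le_sum_of_subset_of_nonneg (Finset.subset_univ _)
        fun p _ _ => by positivity

namespace IsTopSignless

theorem eq_zero_iff (h : K.IsTopSignless ξ) : ξ = 0 ↔ ∀ u v, ¬ K.Adj u v := by
  classical
  constructor
  · rintro rfl u v huv
    have h1 := h.2 1
    have h2 := K.sum_le_signlessForm 1 {(u, v)} (by simpa using huv)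
    simp at h1 h2
    linarith
  · intro hK
    obtain ⟨x, hx, he⟩ := h.1
    have : 0 < ∑ u, x u ^ 2 := by
      obtain ⟨u, hu⟩ := Function.ne_iff.1 hx
      exact Finset.sum_pos' (fun _ _ => sq_nonneg _) ⟨u, Finset.mem_univ _, by
        simp only [Pi.zero_apply] at hu; positivity⟩
    have h0 : K.signlessForm x = 0 := by simp [signlessForm, hK]
    rw [h0] at he
    have := mul_eq_zero.1 he.symm
    rcases this with h | h
    · linarith
    · linarith

open Classical in
-- Test with the indicator of `C`: no edge leaves `C`, so the difference term vanishes, and the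
-- degree term is at least `8 |C|`, to be compared with `2 ξ |C|`.
theorem four_le_of_closed (h : K.IsTopSignless ξ) (C : Set ι) (hne : C.Nonempty)
    (hC : ∀ u ∈ C, ∀ v, K.Adj u v → v ∈ C) (hd : ∀ u ∈ C, 2 ≤ K.degree u) : 4 ≤ ξ := by
  have h1 := h.2 (fun u => if u ∈ C then 1 else 0)
  rw [signlessForm_eq] at h1
  have h2 : ∑ u, ∑ v, (if K.Adj u v then ((if u ∈ C then (1:ℝ) else 0) - (if v ∈ C then 1 else 0)) ^ 2
      else 0) = 0 := by
    refine Finset.sum_eq_zero fun u _ => Finset.sum_eq_zero fun v _ => ?_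
    split_ifs with a b c c
    · simp
    · exact absurd (hC u b v a) c
    · exact absurd (hC v c u a.symm) b
    · simp
    · rfl
  have h3 : 2 * ∑ u, (if u ∈ C then (1:ℝ) else 0) ^ 2 ≤
      ∑ u, (K.degree u : ℝ) * (if u ∈ C then (1:ℝ) else 0) ^ 2 := by
    rw [Finset.mul_sum]
    refine Finset.sum_le_sum fun u _ => ?_
    by_cases hu : u ∈ C
    · have : (2:ℝ) ≤ K.degree u := by exact_mod_cast hd u hu
      simpa [hu] using this
    · simp [hu]
  have h4 : 0 < ∑ u, (if u ∈ C then (1:ℝ) else 0) ^ 2 := by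
    obtain ⟨u, hu⟩ := hne
    exact Finset.sum_pos' (fun _ _ => sq_nonneg _) ⟨u, Finset.mem_univ _, by simp [hu]⟩
  rw [h2] at h1
  by_contra hlt
  push Not at hlt
  nlinarith

open Classical in
-- The vector with 3 at the centre and 1 at three leaves is an eigenvector of the star `K₁,₃` for
-- the eigenvalue 4; the form is `6 · 16 = 96 = 2 · 4 · 12`. A further edge at a leaf adds a
-- positive square, which makes the inequality strict.
theorem star_bound (h : K.IsTopSignless ξ) (c : ι) (N : Finset ι) (hN : ∀ w ∈ N, K.Adj c w)
    (hcard : N.card = 3) : 4 ≤ ξ ∧ ∀ w ∈ N, ∀ v, K.Adj w v → v ≠ c → 4 < ξ := by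
  have hcN : c ∉ N := fun hc => (hN c hc).ne rfl
  set x : ι → ℝ := fun u => if u = c then 3 else if u ∈ N then 1 else 0 with hx
  have hxc : x c = 3 := by simp [hx]
  have hxN : ∀ w ∈ N, x w = 1 := fun w hw => by
    have : w ≠ c := fun h => hcN (h ▸ hw)
    simp [hx, this, hw]
  have hx0 : ∀ w, 0 ≤ x w := fun w => by simp only [hx]; split_ifs <;> norm_num
  have hsum : ∑ u, x u ^ 2 = 12 := by
    have : ∑ u ∈ insert c N, x u ^ 2 = ∑ u, x u ^ 2 :=
      Finset.sum_subset (Finset.subset_univ _) fun u _ hu => by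
        simp only [Finset.mem_insert, not_or] at hu
        simp [hx, hu.1, hu.2]
    rw [← this, Finset.sum_insert hcN, hxc,
      Finset.sum_congr rfl fun w hw => by rw [hxN w hw]]
    simp [hcard]; norm_num
  set S : Finset (ι × ι) := N.image (fun w => (c, w)) ∪ N.image (fun w => (w, c)) with hS
  have hSadj : ∀ p ∈ S, K.Adj p.1 p.2 := by
    intro p hp
    simp only [hS, Finset.mem_union, Finset.mem_image] at hp
    rcases hp with ⟨w, hw, rfl⟩ | ⟨w, hw, rfl⟩
    · exact hN w hw
    · exact (hN w hw).symm
  have hSsum : ∑ p ∈ S, (x p.1 + x p.2) ^ 2 = 96 := by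
    rw [hS, Finset.sum_union, Finset.sum_image (by simp), Finset.sum_image (by simp),
      Finset.sum_congr (g := fun _ => (16 : ℝ)) rfl fun w hw => by
        simp only [hxc, hxN w hw]; norm_num,
      Finset.sum_congr (f := fun w => (x w + x c) ^ 2) (g := fun _ => (16 : ℝ)) rfl fun w hw => by
        simp only [hxc, hxN w hw]; norm_num]
    · simp [hcard]; norm_num
    · rw [Finset.disjoint_left]
      simp only [Finset.mem_image]
      rintro _ ⟨w, hw, rfl⟩ ⟨v, hv, he⟩
      simp only [Prod.mk.injEq] at he
      exact hcN (he.1 ▸ hv)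
  have h1 := h.2 x
  have h2 := K.sum_le_signlessForm x S hSadj
  refine ⟨by rw [hsum] at h1; linarith, fun w hw v hwv hvc => ?_⟩
  have hnot : (w, v) ∉ S := by
    simp only [hS, Finset.mem_union, Finset.mem_image, Prod.mk.injEq]
    rintro (⟨a, ha, h1, h2⟩ | ⟨a, ha, h1, h2⟩)
    · exact hcN (h1 ▸ hw)
    · exact hvc h2.symm
  have h3 := K.sum_le_signlessForm x (insert (w, v) S) (by
    intro p hp
    rcases Finset.mem_insert.1 hp with rfl | hp
    · exact hwv
    · exact hSadj p hp)
  rw [Finset.sum_insert hnot, hSsum, hxN w hw] at h3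
  have := hx0 v
  rw [hsum] at h1
  nlinarith

open Classical in
-- The test vectors above give one direction. Conversely, if `4 ≤ ξ` and degrees are at most 2, an
-- extremal vector is constant along edges and vanishes at vertices of degree at most 1; every
-- vertex reaches such a vertex, so the vector is zero.
theorem lt_four_iff (h : K.IsTopSignless ξ) :
    ξ < 4 ↔ (∀ u, K.degree u ≤ 2) ∧ ∀ u, ∃ v, K.Reachable u v ∧ K.degree v ≤ 1 := by
  constructor
  · intro hlt
    constructor
    · intro u
      by_contra hu
      push Not at hu
      obtain ⟨N, -, hN, hc⟩ := Finset.exists_subsuperset_card_eq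
        (Finset.empty_subset (K.neighborFinset u)) (n := 3) (by simp) (by rw [card_neighborFinset_eq_degree]; omega)
      have := (h.star_bound u N (fun w hw => by simpa using hN hw) hc).1
      linarith
    · intro u
      by_contra! hu
      have := h.four_le_of_closed {v | K.Reachable u v} ⟨u, .refl _⟩
        (fun v hv w hvw => hv.trans hvw.reachable) (fun v hv => hu v hv)
      linarith
  · rintro ⟨hd, hr⟩
    by_contra! hge
    obtain ⟨x, hx, he⟩ := h.1
    rw [signlessForm_eq] at he
    have hs0 : 0 ≤ ∑ u, x u ^ 2 := Finset.sum_nonneg fun _ _ => sq_nonneg _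
    have hD : ∑ u, (2 - K.degree u : ℝ) * x u ^ 2 =
        2 * ∑ u, x u ^ 2 - ∑ u, K.degree u * x u ^ 2 := by
      rw [Finset.mul_sum, ← Finset.sum_sub_distrib]
      exact Finset.sum_congr rfl fun u _ => by ring
    have hd' : ∀ u, (0:ℝ) ≤ 2 - K.degree u := fun u => by
      have : (K.degree u : ℝ) ≤ 2 := by exact_mod_cast hd u
      linarith
    have hD0 : 0 ≤ ∑ u, (2 - K.degree u : ℝ) * x u ^ 2 :=
      Finset.sum_nonneg fun u _ => mul_nonneg (hd' u) (sq_nonneg _)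
    have hE0 : ∀ u, 0 ≤ ∑ v, (if K.Adj u v then (x u - x v) ^ 2 else 0) := fun u =>
      Finset.sum_nonneg fun v _ => by positivity
    have hE1 := Finset.sum_nonneg fun u (_ : u ∈ Finset.univ) => hE0 u
    -- The eigenvalue identity and `4 ≤ ξ` say that four times this sum plus the difference term is
    -- at most 0, and both are nonnegative.
    have hDz : ∑ u, (2 - K.degree u : ℝ) * x u ^ 2 = 0 := by nlinarith
    have hEz : ∑ u, ∑ v, (if K.Adj u v then (x u - x v) ^ 2 else 0) = 0 := by nlinarith
    rw [Finset.sum_eq_zero_iff_of_nonneg fun u _ => mul_nonneg (hd' u) (sq_nonneg _)] at hDz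
    rw [Finset.sum_eq_zero_iff_of_nonneg fun u _ => hE0 u] at hEz
    have hadj : ∀ u v, K.Adj u v → x u = x v := fun u v huv => by
      have := hEz u (Finset.mem_univ _)
      rw [Finset.sum_eq_zero_iff_of_nonneg fun v _ => by positivity] at this
      have := this v (Finset.mem_univ _)
      rw [if_pos huv] at this
      nlinarith [pow_eq_zero_iff (two_ne_zero) |>.1 this]
    obtain ⟨u, hu⟩ := Function.ne_iff.1 hx
    obtain ⟨v, huv, hv⟩ := hr u
    have hxv : x u = x v := by
      obtain ⟨p⟩ := huv
      clear hv
      induction p with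
      | nil => rfl
      | cons e p ih => exact (hadj _ _ e).trans (ih (by rw [← hadj _ _ e]; exact hu))
    have := hDz v (Finset.mem_univ _)
    rw [← hxv] at this
    have h1 : (K.degree v : ℝ) ≤ 1 := by exact_mod_cast hv
    rcases mul_eq_zero.1 this with h | h
    · linarith
    · exact hu (pow_eq_zero_iff (two_ne_zero) |>.1 h)

open Classical in
theorem le_four (h : K.IsTopSignless ξ) (hd : ∀ u, K.degree u ≤ 2) : ξ ≤ 4 := by
  obtain ⟨x, hx, he⟩ := h.1
  rw [signlessForm_eq] at he
  have hE1 : 0 ≤ ∑ u, ∑ v, (if K.Adj u v then (x u - x v) ^ 2 else 0) :=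
    Finset.sum_nonneg fun u _ => Finset.sum_nonneg fun v _ => by positivity
  have hD : ∑ u, K.degree u * x u ^ 2 ≤ 2 * ∑ u, x u ^ 2 := by
    rw [Finset.mul_sum]
    refine Finset.sum_le_sum fun u _ => mul_le_mul_of_nonneg_right ?_ (sq_nonneg _)
    exact_mod_cast hd u
  have : 0 < ∑ u, x u ^ 2 := by
    obtain ⟨u, hu⟩ := Function.ne_iff.1 hx
    exact Finset.sum_pos' (fun _ _ => sq_nonneg _) ⟨u, Finset.mem_univ _, by
      simp only [Pi.zero_apply] at hu; positivity⟩
  by_contra! hlt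
  nlinarith

open Classical in
/-- In a connected graph other than a star, the largest signless Laplacian eigenvalue is `4`
exactly when the graph is `2`-regular. -/
theorem eq_four_iff (h : K.IsTopSignless ξ) (hconn : ∀ u v, K.Reachable u v)
    (hstar : ∀ u, ∃ v, v ≠ u ∧ ¬ K.Adj u v) : ξ = 4 ↔ ∀ u, K.degree u = 2 := by
  constructor
  · rintro rfl
    have hle : ∀ u, K.degree u ≤ 2 := by
      intro c
      by_contra! hc
      -- With three neighbours at `c`, any other edge at a neighbour of `c` would push the
      -- eigenvalue above 4. So all neighbours of `c` are leaves, and connectedness makes `c`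
      -- adjacent to every other vertex.
      have hclosed : ∀ w, K.Adj c w → ∀ v, K.Adj w v → v = c := by
        intro w hw v hwv
        by_contra hvc
        obtain ⟨N, hwN, hN, hcard⟩ := Finset.exists_subsuperset_card_eq (n := 3)
          (s := {w}) (t := K.neighborFinset c) (by simpa using hw) (by simp)
          (by rw [card_neighborFinset_eq_degree]; omega)
        exact lt_irrefl _ ((h.star_bound c N (fun w hw => by simpa using hN hw) hcard).2 w
          (by simpa using hwN) v hwv hvc)
      obtain ⟨v, hvc, hv⟩ := hstar c
      obtain ⟨p⟩ := hconn c v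
      have : ∀ a b (p : K.Walk a b), (a = c ∨ K.Adj c a) → (b = c ∨ K.Adj c b) := by
        intro a b p
        induction p with
        | nil => exact id
        | cons e p ih =>
          rintro (rfl | ha)
          · exact ih (Or.inr e)
          · exact ih (Or.inl (hclosed _ ha _ e))
      rcases this _ _ p (Or.inl rfl) with h | h
      · exact hvc h
      · exact hv h
    intro u
    by_contra hu
    have := h.lt_four_iff.2 ⟨hle, fun v => ⟨u, hconn v u, by have := hle u; omega⟩⟩
    exact lt_irrefl _ this
  · intro hd
    refine le_antisymm (h.le_four fun u => (hd u).le) (not_lt.1 fun hlt => ?_)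
    have hne : Nonempty ι := by
      obtain ⟨x, hx, -⟩ := h.1
      exact (Function.ne_iff.1 hx).nonempty
    obtain ⟨v, -, hv⟩ := (h.lt_four_iff.1 hlt).2 hne.some
    have := hd v
    omega

end IsTopSignless

end SimpleGraph

/-! ### Path and cycle components described by degrees -/

namespace SimpleGraph

variable {X : Type*}

/-- `p 0, …, p m` enumerates `C` without repetition, and two vertices of `C` are adjacent exactly
when they are consecutive. -/
structure IsPathEnum (K : SimpleGraph X) (C : Set X) (m : ℕ) (p : ℕ → X) : Prop where
  inj : ∀ i ≤ m, ∀ j ≤ m, p i = p j → i = j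
  mem_iff : ∀ x, x ∈ C ↔ ∃ i ≤ m, p i = x
  adj_iff : ∀ i ≤ m, ∀ j ≤ m, K.Adj (p i) (p j) ↔ i + 1 = j ∨ j + 1 = i

variable {K : SimpleGraph X} {C : Set X} {m : ℕ} {p : ℕ → X}

/-- Serves as the induction principle for reachability: the property to be propagated is taken as
the set `C`. -/
theorem reachable_mem_of_closed (hC : ∀ u ∈ C, ∀ v, K.Adj u v → v ∈ C) {x y : X}
    (h : K.Reachable x y) (hx : x ∈ C) : y ∈ C := by
  obtain ⟨w⟩ := h
  induction w with
  | nil => exact hx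
  | cons e w ih => exact ih (hC _ hx _ e)

theorem reachable_of_adj_succ {m : ℕ} (h : ∀ i < m, K.Adj (p i) (p (i + 1))) :
    ∀ i ≤ m, K.Reachable (p 0) (p i) := by
  intro i hi
  induction i with
  | zero => rfl
  | succ i ih => exact (ih (by omega)).trans (h i (by omega)).reachable

theorem reachable_of_adj_succ' {m : ℕ} (h : ∀ i < m, K.Adj (p i) (p (i + 1))) {i j : ℕ}
    (hi : i ≤ m) (hj : j ≤ m) : K.Reachable (p i) (p j) :=
  (reachable_of_adj_succ h i hi).symm.trans (reachable_of_adj_succ h j hj)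

theorem exists_seq_of_reachable {x y : X} (h : K.Reachable x y) :
    ∃ (m : ℕ) (p : ℕ → X), p 0 = x ∧ p m = y ∧ (∀ i < m, K.Adj (p i) (p (i + 1))) ∧
      ∀ i ≤ m, ∀ j ≤ m, p i = p j → i = j := by
  obtain ⟨w, hw⟩ := h.exists_isPath
  exact ⟨w.length, w.getVert, by simp, by simp, fun i hi => w.adj_getVert_succ hi,
    fun i hi j hj hij => hw.getVert_injOn hi hj hij⟩

namespace IsPathEnum

theorem reachable (h : K.IsPathEnum C m p) {x y : X} (hx : x ∈ C) (hy : y ∈ C) :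
    K.Reachable x y := by
  obtain ⟨i, hi, rfl⟩ := (h.mem_iff x).1 hx
  obtain ⟨j, hj, rfl⟩ := (h.mem_iff y).1 hy
  exact reachable_of_adj_succ' (fun k hk => (h.adj_iff k (by omega) (k + 1) (by omega)).2
    (Or.inl rfl)) hi hj

theorem neighborSet_subset (h : K.IsPathEnum C m p) (hC : ∀ u ∈ C, ∀ v, K.Adj u v → v ∈ C)
    {i : ℕ} (hi : i ≤ m) : K.neighborSet (p i) ⊆ {p (i - 1), p (i + 1)} := by
  intro y hy
  obtain ⟨j, hj, rfl⟩ := (h.mem_iff y).1 (hC _ ((h.mem_iff _).2 ⟨i, hi, rfl⟩) _ hy)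
  rcases (h.adj_iff i hi j hj).1 hy with rfl | rfl
  · simp
  · simp

theorem ncard_neighborSet_le_two (h : K.IsPathEnum C m p)
    (hC : ∀ u ∈ C, ∀ v, K.Adj u v → v ∈ C) {x : X} (hx : x ∈ C) :
    (K.neighborSet x).ncard ≤ 2 := by
  obtain ⟨i, hi, rfl⟩ := (h.mem_iff x).1 hx
  exact (Set.ncard_le_ncard (h.neighborSet_subset hC hi) (by simp)).trans (by
    simpa using Set.ncard_insert_le (p (i - 1)) {p (i + 1)})

theorem ncard_neighborSet_zero_le_one (h : K.IsPathEnum C m p)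
    (hC : ∀ u ∈ C, ∀ v, K.Adj u v → v ∈ C) : (K.neighborSet (p 0)).ncard ≤ 1 := by
  have : K.neighborSet (p 0) ⊆ {p 1} := by
    intro y hy
    obtain ⟨j, hj, rfl⟩ := (h.mem_iff y).1 (hC _ ((h.mem_iff _).2 ⟨0, by omega, rfl⟩) _ hy)
    rcases (h.adj_iff 0 (by omega) j hj).1 hy with rfl | h
    · simp
    · omega
  exact (Set.ncard_le_ncard this (by simp)).trans (by simp)

end IsPathEnum

theorem eq_or_eq_of_ncard_le_two {s : Set X} (hs : s.Finite) (h : s.ncard ≤ 2) {a b c : X}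
    (ha : a ∈ s) (hb : b ∈ s) (hab : a ≠ b) (hc : c ∈ s) : c = a ∨ c = b := by
  by_contra! hne
  have : ({c, a, b} : Set X).ncard = 3 := by
    rw [Set.ncard_insert_of_notMem (by simp [hne.1, hne.2]), Set.ncard_pair hab]
  have h2 := Set.ncard_le_ncard (s := {c, a, b}) (t := s) (by
    rintro y (rfl | rfl | rfl) <;> assumption) hs
  omega

theorem eq_of_ncard_le_one {s : Set X} (hs : s.Finite) (h : s.ncard ≤ 1) {a b : X}
    (ha : a ∈ s) (hb : b ∈ s) : a = b := (Set.ncard_le_one hs).1 h a ha b hb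

/-- A finite component whose degrees are at most two and that has a vertex `a` of degree at most
one is a path that starts at `a`. -/
theorem exists_isPathEnum (a : X) (hfin : {y | K.Reachable a y}.Finite)
    (h2 : ∀ y, K.Reachable a y → (K.neighborSet y).ncard ≤ 2)
    (h1 : (K.neighborSet a).ncard ≤ 1) :
    ∃ m p, p 0 = a ∧ K.IsPathEnum {y | K.Reachable a y} m p := by
  classical
  set C := {y | K.Reachable a y} with hC
  have hnf : ∀ y, K.Reachable a y → (K.neighborSet y).Finite := fun y hy =>
    hfin.subset fun z hz => hy.trans (Adj.reachable hz)
  -- A longest path from `a` is taken; its length is bounded by the size of the component.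
  let P : ℕ → Prop := fun m => ∃ p : ℕ → X, p 0 = a ∧ (∀ i < m, K.Adj (p i) (p (i + 1))) ∧
      ∀ i ≤ m, ∀ j ≤ m, p i = p j → i = j
  have hP0 : P 0 := ⟨fun _ => a, rfl, by simp, fun i hi j hj _ => by omega⟩
  have hbound : ∀ m, P m → m ≤ C.ncard := by
    rintro m ⟨p, hp0, hadj, hinj⟩
    have hsub : p '' (Set.Iic m) ⊆ C := by
      rintro _ ⟨i, hi, rfl⟩
      change K.Reachable a (p i)
      exact hp0 ▸ reachable_of_adj_succ hadj i hi
    have := Set.ncard_le_ncard hsub hfin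
    have hio : Set.InjOn p (Set.Iic m) := fun i hi j hj => hinj i hi j hj
    rw [hio.ncard_image] at this
    have h3 : (Set.Iic m).ncard = m + 1 := by
      rw [← Finset.coe_Iic, Set.ncard_coe_finset, Nat.card_Iic]
    omega
  obtain ⟨p, hp0, hadj, hinj⟩ := Nat.findGreatest_spec (P := P) (Nat.zero_le C.ncard) hP0
  set m := Nat.findGreatest P C.ncard with hm
  have hmax : ¬ P (m + 1) := fun h => by
    have := Nat.le_findGreatest (hbound _ h) h
    omega
  have hr : ∀ i ≤ m, K.Reachable a (p i) := fun i hi => hp0 ▸ reachable_of_adj_succ hadj i hi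
  -- every neighbour of a vertex of the path is its predecessor or successor
  have hint : ∀ i < m, ∀ y, K.Adj (p i) y → y = p (i + 1) ∨ (0 < i ∧ y = p (i - 1)) := by
    intro i hi y hy
    rcases Nat.eq_zero_or_pos i with rfl | h0
    · left
      rw [hp0] at hy
      exact eq_of_ncard_le_one (hnf a .rfl) h1 hy (hp0 ▸ hadj 0 hi)
    · have hb : K.Adj (p i) (p (i - 1)) := by
        have := (hadj (i - 1) (by omega)).symm
        rwa [Nat.sub_add_cancel h0] at this
      rcases eq_or_eq_of_ncard_le_two (hnf _ (hr i hi.le)) (h2 _ (hr i hi.le)) (hadj i hi) hb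
        (fun he => by have := hinj _ (by omega) _ (by omega) he; omega) hy with h | h
      · exact Or.inl h
      · exact Or.inr ⟨h0, h⟩
  -- A neighbour off the path would extend it. A neighbour `p j` on the path has only its
  -- predecessor and successor as neighbours, so `j + 1 = m`.
  have hlast : ∀ y, K.Adj (p m) y → 0 < m ∧ y = p (m - 1) := by
    intro y hy
    by_cases hmem : ∃ j ≤ m, p j = y
    · obtain ⟨j, hj, rfl⟩ := hmem
      have hjm : j < m := lt_of_le_of_ne hj fun h => hy.ne (by rw [h])
      rcases hint j hjm _ hy.symm with h | ⟨h0, h⟩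
      · have := hinj _ le_rfl _ (by omega) h
        exact ⟨by omega, by congr 1; omega⟩
      · have := hinj _ le_rfl _ (by omega) h
        omega
    · push Not at hmem
      refine absurd ⟨fun i => if i ≤ m then p i else y, by simp [hp0], fun i hi => ?_,
        fun i hi j hj hij => ?_⟩ hmax
      · rcases Nat.lt_or_ge i m with h | h
        · simpa [h.le, h] using hadj i h
        · obtain rfl : i = m := by omega
          simpa using hy
      · by_cases hi' : i ≤ m <;> by_cases hj' : j ≤ m <;> simp only [hi', hj', if_true, if_false] at hij
        · exact hinj i hi' j hj' hij
        · exact absurd hij (hmem i hi')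
        · exact absurd hij.symm (hmem j hj')
        · omega
  have hnext : ∀ i ≤ m, ∀ y, K.Adj (p i) y →
      (i < m ∧ y = p (i + 1)) ∨ (0 < i ∧ y = p (i - 1)) := by
    intro i hi y hy
    rcases hi.lt_or_eq with h | rfl
    · rcases hint i h y hy with h' | h'
      · exact Or.inl ⟨h, h'⟩
      · exact Or.inr h'
    · exact Or.inr (hlast y hy)
  refine ⟨m, p, hp0, hinj, fun x => ⟨fun hx => ?_, ?_⟩, fun i hi j hj => ⟨fun h => ?_, ?_⟩⟩
  · refine reachable_mem_of_closed (C := {x | ∃ i ≤ m, p i = x}) ?_ hx ⟨0, by omega, hp0⟩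
    rintro _ ⟨i, hi, rfl⟩ v hv
    rcases hnext i hi v hv with ⟨h, rfl⟩ | ⟨h, rfl⟩
    · exact ⟨i + 1, h, rfl⟩
    · exact ⟨i - 1, by omega, rfl⟩
  · rintro ⟨i, hi, rfl⟩
    exact hr i hi
  · rcases hnext i hi _ h with ⟨h, he⟩ | ⟨h, he⟩
    · have := hinj _ hj _ (by omega) he
      omega
    · have := hinj _ hj _ (by omega) he
      omega
  · rintro (rfl | rfl)
    · exact hadj i (by omega)
    · exact (hadj j (by omega)).symm

/-- Puts "the component is a path" into the terms of `lt_four_iff`: degrees at most 2 and one vertex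
of degree at most 1 as the starting point. -/
theorem exists_isPathEnum_iff (x : X) (hfin : {y | K.Reachable x y}.Finite) :
    (∃ m p, K.IsPathEnum {y | K.Reachable x y} m p) ↔
      (∀ y, K.Reachable x y → (K.neighborSet y).ncard ≤ 2) ∧
      ∃ y, K.Reachable x y ∧ (K.neighborSet y).ncard ≤ 1 := by
  constructor
  · rintro ⟨m, p, h⟩
    have hC : ∀ u ∈ {y | K.Reachable x y}, ∀ v, K.Adj u v → v ∈ {y | K.Reachable x y} :=
      fun u hu v huv => hu.trans huv.reachable
    exact ⟨fun y hy => h.ncard_neighborSet_le_two hC hy, p 0,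
      (h.mem_iff _).2 ⟨0, by omega, rfl⟩, h.ncard_neighborSet_zero_le_one hC⟩
  · rintro ⟨h2, a, ha, h1⟩
    have hset : {y | K.Reachable x y} = {y | K.Reachable a y} := by
      ext y
      exact ⟨fun h => ha.symm.trans h, fun h => ha.trans h⟩
    rw [hset] at hfin ⊢
    obtain ⟨m, p, -, h⟩ := exists_isPathEnum a hfin (fun y hy => h2 y (ha.trans hy)) h1
    exact ⟨m, p, h⟩

/-- A finite connected `2`-regular graph on the set `C` is a cycle. -/
theorem exists_cycle_enum (x : X) (hfin : {y | K.Reachable x y}.Finite)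
    (h2 : ∀ y, K.Reachable x y → (K.neighborSet y).ncard = 2) :
    ∃ (m : ℕ) (p : ℕ → X), 2 ≤ m ∧ p 0 = x ∧ (∀ i ≤ m, ∀ j ≤ m, p i = p j → i = j) ∧
      (∀ y, K.Reachable x y ↔ ∃ i ≤ m, p i = y) ∧
      (∀ i ≤ m, ∀ j ≤ m, K.Adj (p i) (p j) ↔
        i + 1 = j ∨ j + 1 = i ∨ (i = 0 ∧ j = m) ∨ (i = m ∧ j = 0)) := by
  classical
  have hnf : ∀ y, K.Reachable x y → (K.neighborSet y).Finite := fun y hy =>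
    hfin.subset fun z hz => hy.trans (Adj.reachable hz)
  obtain ⟨y, hy⟩ : (K.neighborSet x).Nonempty := by
    rw [← Set.ncard_pos (hnf x .rfl), h2 x .rfl]; norm_num
  replace hy : K.Adj x y := hy
  -- Deleting one edge at `x` leaves `x` with degree one, so its component in `L` is a path from
  -- `x`. Only `x` and `y` lost a neighbour, so the path must end at `y`, and the deleted edge
  -- closes it.
  set L := K.deleteEdges {s(x, y)} with hL
  have hLadj : ∀ u v, L.Adj u v ↔ K.Adj u v ∧ ¬ (u = x ∧ v = y ∨ u = y ∧ v = x) := fun u v => by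
    simp [hL, deleteEdges_adj]
  have hLK : ∀ z, L.Reachable x z → K.Reachable x z := fun z hz =>
    hz.mono (deleteEdges_le _)
  have hLx : (L.neighborSet x).ncard = 1 := by
    have : L.neighborSet x = K.neighborSet x \ {y} := by
      ext z
      have := hy.ne
      simp only [mem_neighborSet, hLadj, Set.mem_sdiff, Set.mem_singleton_iff, true_and]
      tauto
    rw [this, Set.ncard_sdiff_singleton_of_mem (s := K.neighborSet x) hy, h2 x .rfl]
  have hLfin : {z | L.Reachable x z}.Finite := hfin.subset hLK
  have hLsub : ∀ z, L.neighborSet z ⊆ K.neighborSet z := fun z w hw => ((hLadj _ _).1 hw).1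
  obtain ⟨m, p, hp0, hp⟩ := exists_isPathEnum x hLfin
    (fun z hz => (Set.ncard_le_ncard (hLsub z) (hnf z (hLK z hz))).trans (h2 z (hLK z hz)).le)
    hLx.le
  have hClosed : ∀ u ∈ {z | L.Reachable x z}, ∀ v, L.Adj u v → v ∈ {z | L.Reachable x z} :=
    fun u hu v huv => hu.trans huv.reachable
  have hm0 : 0 < m := by
    by_contra hm
    obtain ⟨z, hz⟩ : (L.neighborSet x).Nonempty := by
      rw [← Set.ncard_pos ((hnf x .rfl).subset (hLsub x)), hLx]; norm_num
    obtain ⟨i, hi, rfl⟩ := (hp.mem_iff z).1 (hClosed x (Reachable.refl _) _ hz)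
    obtain rfl : i = 0 := by omega
    rw [hp0] at hz
    exact L.irrefl ((L.mem_neighborSet x x).1 hz)
  -- the last vertex of the path has degree one in `L`, so it is `y`
  have hpm : p m = y := by
    by_contra hne
    have hmx : p m ≠ x := fun h => by
      have := hp.inj m le_rfl 0 (by omega) (by rw [h, hp0])
      omega
    have hsame : L.neighborSet (p m) = K.neighborSet (p m) := by
      ext z
      simp only [mem_neighborSet, hLadj]
      tauto
    have hmr : L.Reachable x (p m) := (hp.mem_iff _).2 ⟨m, le_rfl, rfl⟩
    have hle : (L.neighborSet (p m)).ncard ≤ 1 := by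
      have : L.neighborSet (p m) ⊆ {p (m - 1)} := by
        intro z hz
        obtain ⟨j, hj, rfl⟩ := (hp.mem_iff z).1 (hClosed _ hmr _ hz)
        rcases (hp.adj_iff m le_rfl j hj).1 hz with h | rfl
        · omega
        · simp
      exact (Set.ncard_le_ncard this (by simp)).trans (by simp)
    rw [hsame, h2 _ (hLK _ hmr)] at hle
    omega
  have hadj : ∀ i ≤ m, ∀ j ≤ m, K.Adj (p i) (p j) ↔
        i + 1 = j ∨ j + 1 = i ∨ (i = 0 ∧ j = m) ∨ (i = m ∧ j = 0) := by
    intro i hi j hj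
    have hKL : K.Adj (p i) (p j) ↔ L.Adj (p i) (p j) ∨ (p i = x ∧ p j = y) ∨
        (p i = y ∧ p j = x) := by
      rw [hLadj]
      constructor
      · intro h; tauto
      · rintro (h | ⟨h, h'⟩ | ⟨h, h'⟩)
        · exact h.1
        · rw [h, h']; exact hy
        · rw [h, h']; exact hy.symm
    have hx' : ∀ k ≤ m, (p k = x ↔ k = 0) := fun k hk =>
      ⟨fun h => hp.inj _ hk _ (by omega) (h.trans hp0.symm), fun h => by rw [h, hp0]⟩
    have hy' : ∀ k ≤ m, (p k = y ↔ k = m) := fun k hk =>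
      ⟨fun h => hp.inj _ hk _ (by omega) (h.trans hpm.symm), fun h => by rw [h, hpm]⟩
    rw [hKL, hp.adj_iff i hi j hj, hx' i hi, hx' j hj, hy' i hi, hy' j hj, or_assoc]
  refine ⟨m, p, ?_, hp0, hp.inj, fun z => ⟨fun hz => ?_, ?_⟩, hadj⟩
  · by_contra hm
    obtain rfl : m = 1 := by omega
    have h01 := (hp.adj_iff 0 (by omega) 1 le_rfl).2 (by omega)
    rw [hp0, hpm, hLadj] at h01
    tauto
  · refine reachable_mem_of_closed (C := {z | ∃ i ≤ m, p i = z}) ?_ hz ⟨0, by omega, hp0⟩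
    rintro _ ⟨i, hi, rfl⟩ v hv
    by_cases hl : L.Adj (p i) v
    · exact (hp.mem_iff v).1 (hClosed _ ((hp.mem_iff _).2 ⟨i, hi, rfl⟩) _ hl)
    · rw [hLadj] at hl
      push Not at hl
      have := hl hv
      rcases this with ⟨-, rfl⟩ | ⟨-, rfl⟩
      · exact ⟨m, le_rfl, hpm⟩
      · exact ⟨0, by omega, hp0⟩
  · rintro ⟨i, hi, rfl⟩
    exact hLK _ ((hp.mem_iff _).2 ⟨i, hi, rfl⟩)

end SimpleGraph

/-! ### The associated graph -/

namespace SimpleMixedGraph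

variable {V : Type*}

/-- The associated graph: two copies of the edges of `G`, on the copies `(v, false)` and
`(v, true)` of its vertices, and an edge from `(u, false)` to `(v, true)` for each arc `(u, v)`. -/
def assoc (G : SimpleMixedGraph V) : SimpleGraph (V × Bool) where
  Adj x y := (x.2 = y.2 ∧ s(x.1, y.1) ∈ G.edges) ∨
    (x.2 = false ∧ y.2 = true ∧ (x.1, y.1) ∈ G.arcs) ∨
    (x.2 = true ∧ y.2 = false ∧ (y.1, x.1) ∈ G.arcs)
  symm := ⟨fun x y h => by
    rcases h with ⟨h, h'⟩ | ⟨h, h', h''⟩ | ⟨h, h', h''⟩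
    · exact Or.inl ⟨h.symm, by rwa [Sym2.eq_swap]⟩
    · exact Or.inr (Or.inr ⟨h', h, h''⟩)
    · exact Or.inr (Or.inl ⟨h', h, h''⟩)⟩
  loopless := ⟨fun x h => by
    rcases h with ⟨-, h'⟩ | ⟨h, h', -⟩ | ⟨h, h', -⟩
    · exact G.edge_loopless _ h' rfl
    · simp [h] at h'
    · simp [h] at h'⟩

variable {G H : SimpleMixedGraph V}

theorem assoc_adj {x y : V × Bool} : G.assoc.Adj x y ↔
    (x.2 = y.2 ∧ s(x.1, y.1) ∈ G.edges) ∨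
    (x.2 = false ∧ y.2 = true ∧ (x.1, y.1) ∈ G.arcs) ∨
    (x.2 = true ∧ y.2 = false ∧ (y.1, x.1) ∈ G.arcs) := Iff.rfl

theorem assoc_adj_same {u v : V} {b : Bool} : G.assoc.Adj (u, b) (v, b) ↔ s(u, v) ∈ G.edges := by
  cases b <;> simp [assoc_adj]

theorem assoc_adj_arc {u v : V} : G.assoc.Adj (u, false) (v, true) ↔ (u, v) ∈ G.arcs := by
  simp [assoc_adj]

theorem assoc_mono (h : H ≤ G) : H.assoc ≤ G.assoc := by
  intro x y hxy
  rcases hxy with ⟨h1, h2⟩ | ⟨h1, h2, h3⟩ | ⟨h1, h2, h3⟩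
  · exact Or.inl ⟨h1, h.2.1 h2⟩
  · exact Or.inr (Or.inl ⟨h1, h2, h.2.2 h3⟩)
  · exact Or.inr (Or.inr ⟨h1, h2, h.2.2 h3⟩)

theorem assoc_adj_mem {x y : V × Bool} (h : G.assoc.Adj x y) : x.1 ∈ G.verts ∧ y.1 ∈ G.verts := by
  rcases h with ⟨-, h⟩ | ⟨-, -, h⟩ | ⟨-, -, h⟩
  · exact ⟨G.edge_mem _ h _ (by simp), G.edge_mem _ h _ (by simp)⟩
  · exact G.arc_mem _ h
  · exact (G.arc_mem _ h).symm

theorem assoc_reachable_mem {x y : V × Bool} (h : G.assoc.Reachable x y) (hx : x.1 ∈ G.verts) :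
    y.1 ∈ G.verts :=
  SimpleGraph.reachable_mem_of_closed (C := {z : V × Bool | z.1 ∈ G.verts})
    (fun _ _ _ huv => (assoc_adj_mem huv).2) h hx

/-- The edge or arc of `G` that underlies an edge of the associated graph. -/
def stepItem (x y : V × Bool) : Sym2 V ⊕ V × V :=
  if x.2 = y.2 then Sum.inl s(x.1, y.1) else if x.2 = false then Sum.inr (x.1, y.1)
  else Sum.inr (y.1, x.1)

theorem stepItem_same {x y : V × Bool} (h : x.2 = y.2) :
    stepItem x y = Sum.inl s(x.1, y.1) := by simp [stepItem, h]

theorem stepItem_comm (x y : V × Bool) : stepItem x y = stepItem y x := by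
  rcases x with ⟨x, _ | _⟩ <;> rcases y with ⟨y, _ | _⟩ <;> simp [stepItem, Sym2.eq_swap]

theorem stepItem_eq_inl {x y : V × Bool} {e : Sym2 V} (h : stepItem x y = Sum.inl e) :
    x.2 = y.2 ∧ e = s(x.1, y.1) := by
  rcases x with ⟨x, _ | _⟩ <;> rcases y with ⟨y, _ | _⟩ <;> simp_all [stepItem, eq_comm]

/-- An arc has only one lift, whereas an edge has one in each copy. This is why arcs may occur once
and edges twice. -/
theorem stepItem_eq_inr {x y : V × Bool} {a : V × V} (h : stepItem x y = Sum.inr a) :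
    s(x, y) = s((a.1, false), (a.2, true)) := by
  rcases x with ⟨x, _ | _⟩ <;> rcases y with ⟨y, _ | _⟩ <;> simp [stepItem] at h <;> subst h <;>
    simp [Sym2.eq_swap]

theorem stepItem_congr {x y z w : V × Bool} (h : s(x, y) = s(z, w)) :
    stepItem x y = stepItem z w := by
  rcases Sym2.eq_iff.1 h with ⟨rfl, rfl⟩ | ⟨rfl, rfl⟩
  · rfl
  · exact stepItem_comm _ _

theorem stepItem_inl_congr {x y z w : V × Bool} {e : Sym2 V} (h : stepItem x y = Sum.inl e)
    (h' : stepItem z w = Sum.inl e) (hb : x.2 = z.2) : s(x, y) = s(z, w) := by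
  obtain ⟨h1, rfl⟩ := stepItem_eq_inl h
  obtain ⟨h2, h3⟩ := stepItem_eq_inl h'
  rcases x with ⟨x, b⟩; rcases y with ⟨y, c⟩; rcases z with ⟨z, d⟩; rcases w with ⟨w, e⟩
  simp only at h1 h2 hb
  subst h1 h2 hb
  rcases Sym2.eq_iff.1 h3 with ⟨rfl, rfl⟩ | ⟨rfl, rfl⟩
  · rfl
  · exact Sym2.eq_swap

/-! ### Lifting alternating walks to the associated graph -/

namespace Walk

/-- `q` is a walk of the associated graph that projects to `W`. -/
def IsLift (W : G.Walk) (q : ℕ → V × Bool) : Prop :=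
  (∀ i : Fin (W.length + 1), (q i).1 = W.vert i) ∧
  ∀ i : Fin W.length, G.assoc.Adj (q i) (q (i + 1)) ∧ W.item i = stepItem (q i) (q (i + 1))

/-- The projection of a walk of the associated graph. -/
def ofSeq (m : ℕ) (q : ℕ → V × Bool) (hadj : ∀ i < m, G.assoc.Adj (q i) (q (i + 1)))
    (h0 : (q 0).1 ∈ G.verts) : G.Walk where
  length := m
  vert i := (q i).1
  item i := stepItem (q i) (q (i + 1))
  vert_mem i := assoc_reachable_mem
    (SimpleGraph.reachable_of_adj_succ hadj i (Nat.lt_succ_iff.1 i.2)) h0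
  item_mem i := by
    simp only [Fin.val_castSucc, Fin.val_succ]
    rcases hadj i i.2 with ⟨h1, h2⟩ | ⟨h1, h2, h3⟩ | ⟨h1, h2, h3⟩
    · exact Or.inl ⟨h2, stepItem_same h1⟩
    · exact Or.inr (Or.inl ⟨h3, by simp [stepItem, h1, h2]⟩)
    · exact Or.inr (Or.inr ⟨h3, by simp [stepItem, h1, h2]⟩)

theorem isLift_ofSeq (m : ℕ) (q : ℕ → V × Bool) (hadj : ∀ i < m, G.assoc.Adj (q i) (q (i + 1)))
    (h0 : (q 0).1 ∈ G.verts) : (ofSeq m q hadj h0).IsLift q :=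
  ⟨fun _ => rfl, fun i => ⟨hadj i i.2, rfl⟩⟩

variable {W : G.Walk} {q : ℕ → V × Bool}

namespace IsLift

theorem adj (h : W.IsLift q) {i : ℕ} (hi : i < W.length) : G.assoc.Adj (q i) (q (i + 1)) :=
  (h.2 ⟨i, hi⟩).1

theorem start_eq (h : W.IsLift q) : W.start = (q 0).1 := (h.1 0).symm

theorem finish_eq (h : W.IsLift q) : W.finish = (q W.length).1 := (h.1 (Fin.last _)).symm

theorem reachable (h : W.IsLift q) {i j : ℕ} (hi : i ≤ W.length) (hj : j ≤ W.length) :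
    G.assoc.Reachable (q i) (q j) :=
  SimpleGraph.reachable_of_adj_succ' (p := q) (fun _ hk => h.adj hk) hi hj

theorem isArcAt_iff (h : W.IsLift q) (i : Fin W.length) :
    W.IsArcAt i ↔ (q i).2 ≠ (q (i + 1)).2 := by
  unfold IsArcAt
  rw [(h.2 i).2, stepItem]
  split_ifs with h1 h2 <;> simp [h1]

theorem isForwardAt_iff (h : W.IsLift q) (i : Fin W.length) :
    W.IsForwardAt i ↔ (q i).2 = false ∧ (q (i + 1)).2 = true := by
  have h1 := h.1 i.castSucc
  have h2 := h.1 i.succ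
  have hadj := (h.2 i).1
  simp only [Fin.val_castSucc, Fin.val_succ] at h1 h2
  unfold IsForwardAt
  rw [(h.2 i).2, ← h1, ← h2, stepItem]
  split_ifs with h3 h4
  · simp [h3]
  · simp only [true_iff]
    exact ⟨h4, by rw [h4] at h3; simpa using h3⟩
  · refine iff_of_false (fun he => ?_) (fun he => h4 he.1)
    simp only [Sum.inr.injEq, Prod.mk.injEq] at he
    rcases hadj with ⟨h6, -⟩ | ⟨h6, -⟩ | ⟨-, -, h6⟩
    · exact h3 h6
    · exact h4 h6
    · exact G.arc_loopless _ h6 he.1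

theorem bit_const (h : W.IsLift q) {i j : ℕ} (hij : i ≤ j) (hj : j ≤ W.length)
    (hc : ∀ k : Fin W.length, i ≤ k → (k : ℕ) < j → ¬ W.IsArcAt k) : (q i).2 = (q j).2 := by
  induction j, hij using Nat.le_induction with
  | base => rfl
  | succ j hij ih =>
    rw [ih (by omega) fun k h1 h2 => hc k h1 (by omega)]
    have := hc ⟨j, by omega⟩ hij (by simp)
    rw [h.isArcAt_iff] at this
    simpa using this

/-- A forward arc goes from `false` to `true` and a backward arc from `true` to `false`; edges keep
the bit, so the next arc must start where the previous one ended and has the opposite direction. -/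
theorem isAlternating (h : W.IsLift q) (hne : G.arcs.Nonempty) : W.IsAlternating := by
  refine ⟨hne, fun i j hij hi hj hk => ?_⟩
  have hc : (q (i + 1)).2 = (q j).2 := h.bit_const (by omega) (by omega) fun k h1 h2 =>
    hk k (by rw [Fin.lt_def]; omega) (by rw [Fin.lt_def]; omega)
  rw [h.isArcAt_iff] at hi hj
  rw [hc] at hi
  rw [h.isForwardAt_iff, h.isForwardAt_iff, hc]
  revert hi hj
  cases (q i).2 <;> cases (q j).2 <;> cases (q (j + 1)).2 <;> simp

/-- The bit flips at each arc and nowhere else. All parity conditions in the definitions are read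
through this equivalence. -/
theorem odd_ncard_iff (h : W.IsLift q) {i j : ℕ} (hij : i ≤ j) (hj : j ≤ W.length) :
    Odd {k : Fin W.length | i ≤ k ∧ (k : ℕ) < j ∧ W.IsArcAt k}.ncard ↔ (q i).2 ≠ (q j).2 := by
  induction j, hij using Nat.le_induction with
  | base =>
    have : {k : Fin W.length | i ≤ k ∧ (k : ℕ) < i ∧ W.IsArcAt k} = ∅ := by
      ext k; simp; omega
    simp [this]
  | succ j hij ih =>
    have ih := ih (by omega)
    have ha := h.isArcAt_iff ⟨j, by omega⟩
    simp only at ha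
    by_cases hb : (q j).2 = (q (j + 1)).2
    · have : {k : Fin W.length | i ≤ k ∧ (k : ℕ) < j + 1 ∧ W.IsArcAt k} =
          {k : Fin W.length | i ≤ k ∧ (k : ℕ) < j ∧ W.IsArcAt k} := by
        ext k
        simp only [Set.mem_ofPred_eq]
        constructor
        · rintro ⟨h1, h2, h3⟩
          refine ⟨h1, lt_of_le_of_ne (by omega) fun hk => ?_, h3⟩
          have hk' : k = ⟨j, by omega⟩ := Fin.ext hk
          exact ha.1 (hk' ▸ h3) hb
        · rintro ⟨h1, h2, h3⟩
          exact ⟨h1, by omega, h3⟩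
      rw [this, ih, hb]
    · have : {k : Fin W.length | i ≤ k ∧ (k : ℕ) < j + 1 ∧ W.IsArcAt k} =
          insert ⟨j, by omega⟩ {k : Fin W.length | i ≤ k ∧ (k : ℕ) < j ∧ W.IsArcAt k} := by
        ext k
        simp only [Set.mem_ofPred_eq, Set.mem_insert_iff, Fin.ext_iff]
        constructor
        · rintro ⟨h1, h2, h3⟩
          by_cases hk : (k : ℕ) = j
          · exact Or.inl hk
          · exact Or.inr ⟨h1, by omega, h3⟩
        · rintro (hk | ⟨h1, h2, h3⟩)
          · refine ⟨by omega, by omega, ?_⟩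
            have hk' : k = ⟨j, by omega⟩ := Fin.ext hk
            exact hk' ▸ ha.2 hb
          · exact ⟨h1, by omega, h3⟩
      rw [this, Set.ncard_insert_of_notMem (by simp), Nat.odd_add_one, ih]
      revert hb
      cases (q i).2 <;> cases (q j).2 <;> cases (q (j + 1)).2 <;> simp

theorem odd_arcCount_iff (h : W.IsLift q) : Odd W.arcCount ↔ (q 0).2 ≠ (q W.length).2 := by
  rw [← h.odd_ncard_iff (Nat.zero_le _) le_rfl]
  simp [arcCount]

/-- Occurrences of `v` separated by an odd number of arcs lie on different copies of `v`. The bound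
by two then comes from there being two copies. -/
theorem vertexCondition_iff (h : W.IsLift q) :
    W.VertexCondition ↔ ∀ i ≤ W.length, ∀ j ≤ W.length, q i = q j → i = j := by
  have hpar : ∀ i j : Fin (W.length + 1), i < j →
      (Odd {k : Fin W.length | i ≤ k.castSucc ∧ k.castSucc < j ∧ W.IsArcAt k}.ncard ↔
        (q i).2 ≠ (q j).2) := fun i j hij => by
    rw [← h.odd_ncard_iff (Fin.lt_def.1 hij).le (Nat.lt_succ_iff.1 j.2)]
    simp [Fin.le_def, Fin.lt_def]
  constructor
  · rintro ⟨-, h2⟩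
    have : ∀ i ≤ W.length, ∀ j ≤ W.length, i < j → q i ≠ q j := fun i hi j hj hij he => by
      have hlt : (⟨i, by omega⟩ : Fin (W.length + 1)) < ⟨j, by omega⟩ := hij
      refine (hpar _ _ hlt).1 (h2 _ _ hlt ?_) (by simp [he])
      rw [← h.1, ← h.1]
      simp [he]
    intro i hi j hj he
    rcases lt_trichotomy i j with h | h | h
    · exact absurd he (this i hi j hj h)
    · exact h
    · exact absurd he.symm (this j hj i hi h)
  · intro hinj
    have key : ∀ i j : Fin (W.length + 1), W.vert i = W.vert j → (q i).2 = (q j).2 → i = j :=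
      fun i j hv hb => Fin.ext (hinj i (Nat.lt_succ_iff.1 i.2) j (Nat.lt_succ_iff.1 j.2)
        (Prod.ext (by rw [h.1, h.1, hv]) hb))
    refine ⟨fun v => ?_, fun i j hij hv => (hpar i j hij).2 fun hb => hij.ne (key i j hv hb)⟩
    have := Set.ncard_le_ncard_of_injOn (s := {i | W.vert i = v}) (t := (Set.univ : Set Bool))
      (fun i => (q i).2) (by simp) (fun i hi j hj hb => key i j (hi.trans hj.symm) hb)
    unfold vertCount
    simpa [Set.ncard_univ] using this

/-- Together the two conditions say that the lift is a trail: the parity condition separates the two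
lifts of an edge, and the arc condition handles the single lift of an arc. An edge keeps the bit, so
counting arcs strictly between two traversals compares the copies in which they take place. -/
theorem edgeCondition_and_arcCondition_iff (h : W.IsLift q) :
    W.EdgeCondition ∧ W.ArcCondition ↔
      ∀ i < W.length, ∀ j < W.length, s(q i, q (i + 1)) = s(q j, q (j + 1)) → i = j := by
  have hpar : ∀ i j : Fin W.length, i < j →
      (Odd {k : Fin W.length | i < k ∧ k < j ∧ W.IsArcAt k}.ncard ↔
        (q (i + 1)).2 ≠ (q j).2) := fun i j hij => by
    have := Fin.lt_def.1 hij
    rw [← h.odd_ncard_iff (by omega) (by omega)]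
    simp only [Fin.lt_def, Nat.succ_le_iff]
  constructor
  · rintro ⟨⟨-, h2⟩, h3⟩
    have : ∀ i < W.length, ∀ j < W.length, i < j → s(q i, q (i + 1)) ≠ s(q j, q (j + 1)) := by
      intro i hi j hj hij he
      have hlt : (⟨i, hi⟩ : Fin W.length) < ⟨j, hj⟩ := hij
      have hi' := (h.2 ⟨i, hi⟩).2
      have hj' := (h.2 ⟨j, hj⟩).2
      simp only at hi' hj'
      rw [stepItem_congr he] at hi'
      rcases hit : stepItem (q j) (q (j + 1)) with e | a
      · have hb := stepItem_eq_inl hit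
        have hb' := stepItem_eq_inl ((stepItem_congr he).trans hit)
        refine (hpar _ _ hlt).1 (h2 _ _ e hlt (hi'.trans hit) (hj'.trans hit)) ?_
        rcases Sym2.eq_iff.1 he with ⟨h4, h5⟩ | ⟨h4, h5⟩
        · simp only [h5, hb.1]
        · simp only [h5]
      · have h4 := h3 a
        have : ({⟨i, hi⟩, ⟨j, hj⟩} : Set (Fin W.length)) ⊆ {k | W.item k = Sum.inr a} := by
          rintro k (rfl | rfl)
          · exact hi'.trans hit
          · exact hj'.trans hit
        have h5 := Set.ncard_le_ncard this (Set.toFinite _)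
        rw [Set.ncard_pair hlt.ne] at h5
        unfold arcOccurrences at h4
        omega
    intro i hi j hj he
    rcases lt_trichotomy i j with h | h | h
    · exact absurd he (this i hi j hj h)
    · exact h
    · exact absurd he.symm (this j hj i hi h)
  · intro htr
    have key : ∀ (i j : Fin W.length) (e : Sym2 V), W.item i = Sum.inl e → W.item j = Sum.inl e →
        (q i).2 = (q j).2 → i = j := fun i j e hi hj hb => by
      rw [(h.2 _).2] at hi hj
      exact Fin.ext (htr i i.2 j j.2 (stepItem_inl_congr hi hj hb))
    refine ⟨⟨fun e => ?_, fun i j e hij hi hj => (hpar i j hij).2 fun hb => ?_⟩, fun a => ?_⟩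
    · have := Set.ncard_le_ncard_of_injOn (s := {i | W.item i = Sum.inl e})
        (t := (Set.univ : Set Bool)) (fun i => (q i).2) (by simp)
        (fun i hi j hj hb => key i j e hi hj hb)
      unfold edgeCount
      simpa [Set.ncard_univ] using this
    · refine hij.ne (key i j e hi hj ?_)
      rw [(h.2 i).2] at hi
      rw [← hb, (stepItem_eq_inl hi).1]
    · unfold arcOccurrences
      refine (Set.ncard_le_one (Set.toFinite _)).2 fun i hi j hj => ?_
      simp only [Set.mem_ofPred_eq] at hi hj
      rw [(h.2 _).2] at hi hj
      exact Fin.ext (htr i i.2 j j.2 ((stepItem_eq_inr hi).trans (stepItem_eq_inr hj).symm))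

theorem trail_of_inj (hinj : ∀ i ≤ W.length, ∀ j ≤ W.length, q i = q j → i = j) :
    ∀ i < W.length, ∀ j < W.length, s(q i, q (i + 1)) = s(q j, q (j + 1)) → i = j := by
  intro i hi j hj he
  rcases Sym2.eq_iff.1 he with ⟨h1, -⟩ | ⟨h1, h2⟩
  · exact hinj _ hi.le _ hj.le h1
  · have := hinj _ hi.le _ hj h1
    have := hinj _ hi _ hj.le h2
    omega

/-- The edge and arc conditions follow from the vertex condition, because a path is a trail. -/
theorem isAlternatingPath_iff (h : W.IsLift q) (hne : G.arcs.Nonempty) :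
    W.IsAlternatingPath ↔ ∀ i ≤ W.length, ∀ j ≤ W.length, q i = q j → i = j := by
  rw [← h.vertexCondition_iff]
  refine ⟨fun hW => hW.2.1, fun hW => ⟨h.isAlternating hne, hW, ?_⟩⟩
  exact h.edgeCondition_and_arcCondition_iff.2 (trail_of_inj (h.vertexCondition_iff.1 hW))

theorem vertCount_eq (h : W.IsLift q)
    (hinj : ∀ i ≤ W.length, ∀ j ≤ W.length, q i = q j → i = j) (v : V) :
    W.vertCount v = {b : Bool | ∃ i ≤ W.length, q i = (v, b)}.ncard := by
  refine Set.ncard_congr (fun i _ => (q i).2) ?_ ?_ ?_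
  · intro i hi
    exact ⟨i, Nat.lt_succ_iff.1 i.2, Prod.ext ((h.1 i).trans hi) rfl⟩
  · intro i j hi hj hb
    exact Fin.ext (hinj i (Nat.lt_succ_iff.1 i.2) j (Nat.lt_succ_iff.1 j.2)
        (Prod.ext (by rw [h.1, h.1, hi, hj]) hb))
  · rintro b ⟨i, hi, he⟩
    exact ⟨⟨i, by omega⟩, by simp [← h.1, he], by simp [he]⟩

theorem edgeCount_eq (h : W.IsLift q)
    (htr : ∀ i < W.length, ∀ j < W.length, s(q i, q (i + 1)) = s(q j, q (j + 1)) → i = j)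
    (u v : V) : W.edgeCount s(u, v) =
      {b : Bool | ∃ i < W.length, s(q i, q (i + 1)) = s((u, b), (v, b))}.ncard := by
  refine Set.ncard_congr (fun i _ => (q i).2) ?_ ?_ ?_
  · intro i hi
    simp only [Set.mem_ofPred_eq, (h.2 i).2] at hi
    exact ⟨i, i.2, stepItem_inl_congr hi (by simp [stepItem]) rfl⟩
  · intro i j hi hj hb
    simp only [Set.mem_ofPred_eq, (h.2 _).2] at hi hj
    exact Fin.ext (htr i i.2 j j.2 (stepItem_inl_congr hi hj hb))
  · rintro b ⟨i, hi, he⟩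
    refine ⟨⟨i, hi⟩, ?_, ?_⟩
    · simp only [Set.mem_ofPred_eq, (h.2 _).2]
      rw [stepItem_congr he]
      simp [stepItem]
    · rcases Sym2.eq_iff.1 he with ⟨h1, -⟩ | ⟨h1, -⟩ <;> simp [h1]

theorem arcOccurrences_pos_iff (h : W.IsLift q) (a : V × V) :
    1 ≤ W.arcOccurrences a ↔
      ∃ i < W.length, s(q i, q (i + 1)) = s((a.1, false), (a.2, true)) := by
  unfold arcOccurrences
  rw [Nat.one_le_iff_ne_zero, ← Nat.pos_iff_ne_zero, Set.ncard_pos]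
  constructor
  · rintro ⟨i, hi⟩
    simp only [Set.mem_ofPred_eq, (h.2 _).2] at hi
    exact ⟨i, i.2, stepItem_eq_inr hi⟩
  · rintro ⟨i, hi, he⟩
    refine ⟨⟨i, hi⟩, ?_⟩
    simp only [Set.mem_ofPred_eq, (h.2 _).2]
    rw [stepItem_congr he]
    simp [stepItem]

end IsLift

/-- The bit sequence of a lift: after an arc the bit is determined by the direction in which the
arc was traversed, and it does not change along edges. -/
def IsBitSeq (W : G.Walk) (b : ℕ → Bool) : Prop :=
  ∀ i : Fin W.length, (¬ W.IsArcAt i → b (i + 1) = b i) ∧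
    (W.IsArcAt i → (b (i + 1) = !b i) ∧ (W.IsForwardAt i ↔ b i = false))

theorem IsBitSeq.exists_isLift {b : ℕ → Bool} (h : W.IsBitSeq b) :
    ∃ q, W.IsLift q ∧ ∀ i, (q i).2 = b i := by
  -- Lifts are indexed by all of `ℕ`; clamping the index repeats the last vertex beyond the end,
  -- where values do not matter.
  refine ⟨fun i => (W.vert ⟨min i W.length, by omega⟩, b i), ⟨fun i => ?_, fun i => ?_⟩,
    fun _ => rfl⟩
  · simp only
    congr 1
    exact Fin.ext (by simp; omega)
  · have e1 : (⟨min (i : ℕ) W.length, by omega⟩ : Fin (W.length + 1)) = i.castSucc :=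
      Fin.ext (by simp)
    have e2 : (⟨min ((i : ℕ) + 1) W.length, by omega⟩ : Fin (W.length + 1)) = i.succ :=
      Fin.ext (by simp)
    simp only [e1, e2]
    have hi := W.item_mem i
    rcases hi with ⟨hm, hi⟩ | ⟨hm, hi⟩ | ⟨hm, hi⟩
    · have hb := (h i).1 (by simp [IsArcAt, hi])
      rw [hb, hi]
      exact ⟨assoc_adj_same.2 hm, by simp [stepItem]⟩
    · obtain ⟨hb, hf⟩ := (h i).2 (by simp [IsArcAt, hi])
      have hb0 := hf.1 hi
      rw [hb, hb0, hi]
      exact ⟨assoc_adj_arc.2 hm, by simp [stepItem]⟩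
    · obtain ⟨hb, hf⟩ := (h i).2 (by simp [IsArcAt, hi])
      have hb0 : b i = true := by
        rw [← Bool.not_eq_false, ← hf, IsForwardAt, hi]
        intro he
        simp only [Sum.inr.injEq, Prod.mk.injEq] at he
        exact G.arc_loopless _ hm he.1
      rw [hb, hb0, hi]
      exact ⟨(assoc_adj_arc.2 hm).symm, by simp [stepItem]⟩

theorem exists_isLift_of_no_arc (hW : ∀ i, ¬ W.IsArcAt i) (b : Bool) :
    ∃ q, W.IsLift q ∧ ∀ i, (q i).2 = b :=
  IsBitSeq.exists_isLift (b := fun _ => b) fun i => ⟨fun _ => rfl, fun h => absurd h (hW i)⟩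

open Classical in
-- The direction of the first arc forces the initial bit, and the direction of each arc forces the
-- bit after it. Alternation says precisely that this is the bit required at the next arc. A walk
-- without arcs lifts to either copy.
theorem IsAlternating.exists_isLift (hW : W.IsAlternating) : ∃ q, W.IsLift q := by
  by_cases hno : ∀ i, ¬ W.IsArcAt i
  · obtain ⟨q, hq, -⟩ := exists_isLift_of_no_arc hno true
    exact ⟨q, hq⟩
  push Not at hno
  obtain ⟨i₀, hi₀, hmin⟩ : ∃ i₀, W.IsArcAt i₀ ∧ ∀ k, W.IsArcAt k → i₀ ≤ k := by
    obtain ⟨i₀, h1, h2⟩ := Set.exists_min_image {i | W.IsArcAt i} id (Set.toFinite _) hno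
    exact ⟨i₀, h1, h2⟩
  let b : ℕ → Bool := fun n => Nat.rec (decide (¬ W.IsForwardAt i₀))
    (fun i c => if h : i < W.length then
      (if W.IsArcAt ⟨i, h⟩ then decide (W.IsForwardAt ⟨i, h⟩) else c) else c) n
  have hb0 : b 0 = decide (¬ W.IsForwardAt i₀) := rfl
  have hbs : ∀ i : Fin W.length, b (i + 1) =
      if W.IsArcAt i then decide (W.IsForwardAt i) else b i := fun i => by
    change (if h : (i : ℕ) < W.length then
      (if W.IsArcAt ⟨i, h⟩ then decide (W.IsForwardAt ⟨i, h⟩) else b i) else b i) = _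
    simp
  -- Either no arc has been used before position `n`, or `j` is the last arc used and determines the
  -- current bit.
  have inv : ∀ n ≤ W.length, (b n = decide (¬ W.IsForwardAt i₀) ∧ n ≤ i₀) ∨
      ∃ j : Fin W.length, W.IsArcAt j ∧ (j : ℕ) < n ∧ b n = decide (W.IsForwardAt j) ∧
        ∀ k : Fin W.length, j < k → (k : ℕ) < n → ¬ W.IsArcAt k := by
    intro n hn
    induction n with
    | zero => exact Or.inl ⟨hb0, by omega⟩
    | succ n ih =>
      have hs := hbs ⟨n, hn⟩
      simp only at hs
      by_cases ha : W.IsArcAt ⟨n, hn⟩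
      · rw [if_pos ha] at hs
        refine Or.inr ⟨⟨n, hn⟩, ha, by simp, hs, fun k h1 h2 => ?_⟩
        rw [Fin.lt_def] at h1
        simp only at h1
        omega
      · rw [if_neg ha] at hs
        rcases ih (by omega) with ⟨h1, h2⟩ | ⟨j, h1, h2, h3, h4⟩
        · refine Or.inl ⟨hs.trans h1, ?_⟩
          have : n ≠ i₀ := fun h => ha (by
            have : (⟨n, hn⟩ : Fin W.length) = i₀ := Fin.ext h
            rwa [this])
          omega
        · refine Or.inr ⟨j, h1, by omega, hs.trans h3, fun k h5 h6 => ?_⟩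
          by_cases hk : (k : ℕ) = n
          · have : k = ⟨n, hn⟩ := Fin.ext hk
            rwa [this]
          · exact h4 k h5 (by omega)
  obtain ⟨q, hq, -⟩ := IsBitSeq.exists_isLift (W := W) (b := b) (fun i => by
    refine ⟨fun h => by rw [hbs, if_neg h], fun h => ?_⟩
    have hbi : b i = decide (¬ W.IsForwardAt i) := by
      rcases inv i i.2.le with ⟨h1, h2⟩ | ⟨j, h1, h2, h3, h4⟩
      · have : i₀ = i := le_antisymm (hmin i h) (Fin.le_def.2 h2)
        rw [h1, this]
      · rw [h3]
        have := hW.2 j i (Fin.lt_def.2 h2) h1 h (fun k h5 h6 => h4 k h5 (Fin.lt_def.1 h6))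
        simp only [decide_eq_decide]
        exact this
    rw [hbs, if_pos h, hbi]
    by_cases hf : W.IsForwardAt i <;> simp [hf])
  exact ⟨q, hq⟩

end Walk

theorem exists_walk_of_reachable {x y : V × Bool} (h : G.assoc.Reachable x y)
    (hx : x.1 ∈ G.verts) : ∃ (W : G.Walk) (q : ℕ → V × Bool), W.IsLift q ∧ q 0 = x ∧
      q W.length = y ∧ ∀ i ≤ W.length, ∀ j ≤ W.length, q i = q j → i = j := by
  obtain ⟨m, q, rfl, rfl, hadj, hinj⟩ := SimpleGraph.exists_seq_of_reachable h
  exact ⟨Walk.ofSeq m q hadj hx, q, Walk.isLift_ofSeq _ _ _ _, rfl, rfl, hinj⟩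

end SimpleMixedGraph

/-! ### Mixed components and components of the associated graph -/

namespace SimpleMixedGraph

variable {V : Type*} {G H T : SimpleMixedGraph V}

theorem le_antisymm' {A B : SimpleMixedGraph V} (h : A ≤ B) (h' : B ≤ A) : A = B :=
  SimpleMixedGraph.ext (h.1.antisymm h'.1) (h.2.1.antisymm h'.2.1) (h.2.2.antisymm h'.2.2)

/-- The undirected part of `G` as a simple graph on `V`. -/
def toSimpleGraph (G : SimpleMixedGraph V) : SimpleGraph V where
  Adj u v := s(u, v) ∈ G.edges
  symm := ⟨fun u v h => by rwa [Sym2.eq_swap]⟩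
  loopless := ⟨fun u h => G.edge_loopless _ h rfl⟩

theorem assoc_reachable_of_toSimpleGraph {u v : V} (h : G.toSimpleGraph.Reachable u v) (b : Bool) :
    G.assoc.Reachable (u, b) (v, b) :=
  SimpleGraph.reachable_mem_of_closed (C := {w | G.assoc.Reachable (u, b) (w, b)})
    (fun _ hw _ hwz => SimpleGraph.Reachable.trans hw
      (SimpleGraph.Adj.reachable (assoc_adj_same.2 hwz))) h (SimpleGraph.Reachable.refl _)

theorem toSimpleGraph_reachable_mem {u v : V} (h : G.toSimpleGraph.Reachable u v)
    (hu : u ∈ G.verts) : v ∈ G.verts :=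
  assoc_reachable_mem (assoc_reachable_of_toSimpleGraph h false) hu

/-- A walk of the associated graph stays on one copy of a component of the undirected part until
it first uses an arc. -/
theorem reachable_cases {u : V} {b : Bool} {z : V × Bool} (h : G.assoc.Reachable (u, b) z) :
    (z.2 = b ∧ G.toSimpleGraph.Reachable u z.1) ∨
      ∃ v w, G.toSimpleGraph.Reachable u v ∧ G.assoc.Adj (v, b) (w, !b) := by
  by_cases hex : ∃ v w, G.toSimpleGraph.Reachable u v ∧ G.assoc.Adj (v, b) (w, !b)
  · exact Or.inr hex
  · refine Or.inl (SimpleGraph.reachable_mem_of_closed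
      (C := {z : V × Bool | z.2 = b ∧ G.toSimpleGraph.Reachable u z.1}) ?_ h ⟨rfl, .refl _⟩)
    rintro ⟨v, c⟩ ⟨rfl, hv⟩ ⟨w, d⟩ hvw
    simp only at hv
    by_cases hd : d = c
    · subst hd
      exact ⟨rfl, hv.trans (SimpleGraph.Adj.reachable (assoc_adj_same.1 hvw))⟩
    · obtain rfl : d = !c := by cases c <;> cases d <;> simp_all
      exact absurd ⟨v, w, hv, hvw⟩ hex

/-! ### Components of the undirected part -/

/-- The component of the undirected part of `G` that contains `u`. -/
def undirectedComp (G : SimpleMixedGraph V) (u : V) : SimpleMixedGraph V where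
  verts := {v | v ∈ G.verts ∧ G.toSimpleGraph.Reachable u v}
  edges := {e | e ∈ G.edges ∧ ∀ v ∈ e, G.toSimpleGraph.Reachable u v}
  arcs := ∅
  edge_mem e he v hv := ⟨G.edge_mem e he.1 v hv, he.2 v hv⟩
  arc_mem := by simp
  edge_loopless e he := G.edge_loopless e he.1
  arc_loopless := by simp

theorem mem_undirectedComp {u v : V} (hu : u ∈ G.verts) :
    v ∈ (G.undirectedComp u).verts ↔ G.toSimpleGraph.Reachable u v :=
  ⟨fun h => h.2, fun h => ⟨toSimpleGraph_reachable_mem h hu, h⟩⟩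

theorem undirectedComp_le (u : V) : G.undirectedComp u ≤ G.undirectedPart :=
  ⟨fun _ h => h.1, fun _ h => h.1, subset_rfl⟩

theorem mem_undirectedComp_edges {u v w : V} (hv : G.toSimpleGraph.Reachable u v) :
    s(v, w) ∈ (G.undirectedComp u).edges ↔ s(v, w) ∈ G.edges := by
  refine ⟨fun h => h.1, fun h => ⟨h, fun z hz => ?_⟩⟩
  rcases Sym2.mem_iff.1 hz with rfl | rfl
  · exact hv
  · exact hv.trans (SimpleGraph.Adj.reachable h)

theorem undirectedComp_reachable {u v w : V} (hv : G.toSimpleGraph.Reachable u v)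
    (hw : G.toSimpleGraph.Reachable v w) : (G.undirectedComp u).toSimpleGraph.Reachable v w :=
  (SimpleGraph.reachable_mem_of_closed
    (C := {w | G.toSimpleGraph.Reachable u w ∧ (G.undirectedComp u).toSimpleGraph.Reachable v w})
    (fun _ hz _ hzy => ⟨hz.1.trans (SimpleGraph.Adj.reachable hzy), hz.2.trans
      (SimpleGraph.Adj.reachable ((mem_undirectedComp_edges hz.1).2 hzy))⟩) hw
    ⟨hv, .refl _⟩).2

theorem undirectedComp_connected {u : V} (hu : u ∈ G.verts) : (G.undirectedComp u).Connected := by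
  refine ⟨⟨u, hu, .refl _⟩, fun v hv w hw => ?_⟩
  obtain ⟨W, q, hq, h0, h1, -⟩ := exists_walk_of_reachable (assoc_reachable_of_toSimpleGraph
    (undirectedComp_reachable hv.2 (hv.2.symm.trans hw.2)) false) hv
  exact ⟨W, by rw [hq.start_eq, h0], by rw [hq.finish_eq, h1]⟩

theorem reachable_of_walk (hle : H ≤ G.undirectedPart) (W : H.Walk) :
    G.toSimpleGraph.Reachable W.start W.finish := by
  obtain ⟨q, hq, -⟩ := Walk.exists_isLift_of_no_arc (W := W) (fun i ⟨a, ha⟩ => by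
    rcases W.item_mem i with ⟨-, h⟩ | ⟨h, -⟩ | ⟨h, -⟩
    · simp [ha] at h
    · exact hle.2.2 h
    · exact hle.2.2 h) false
  have := (hq.reachable (Nat.zero_le _) le_rfl).mono (assoc_mono hle)
  rw [hq.start_eq, hq.finish_eq]
  rcases reachable_cases (u := (q 0).1) (b := (q 0).2) this with h | ⟨v, w, -, h⟩
  · exact h.2
  · rcases h with ⟨h, -⟩ | ⟨-, -, h⟩ | ⟨-, -, h⟩
    · simp at h
    · exact absurd h (Set.notMem_empty _)
    · exact absurd h (Set.notMem_empty _)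

theorem le_undirectedComp (hle : H ≤ G.undirectedPart) (hH : H.Connected) {u : V}
    (hu : u ∈ H.verts) : H ≤ G.undirectedComp u := by
  have hr : ∀ v ∈ H.verts, G.toSimpleGraph.Reachable u v := fun v hv => by
    obtain ⟨W, rfl, rfl⟩ := hH.2 u hu v hv
    exact reachable_of_walk hle W
  exact ⟨fun v hv => ⟨hle.1 hv, hr v hv⟩,
    fun e he => ⟨hle.2.1 he, fun v hv => hr v (H.edge_mem e he v hv)⟩, hle.2.2⟩

theorem isComponent_undirectedComp {u : V} (hu : u ∈ G.verts) :
    (G.undirectedComp u).IsComponent G.undirectedPart :=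
  ⟨⟨undirectedComp_le u, undirectedComp_connected hu⟩,
    fun _ hK hle => le_undirectedComp hK.1 hK.2 (hle.1 ⟨hu, .refl _⟩)⟩

theorem IsComponent.eq_undirectedComp (h : H.IsComponent G.undirectedPart) {u : V}
    (hu : u ∈ H.verts) : H = G.undirectedComp u := by
  have hle := le_undirectedComp h.1.1 h.1.2 hu
  exact le_antisymm' hle (h.2 ⟨undirectedComp_le u,
    undirectedComp_connected (h.1.1.1 hu)⟩ hle)

/-! ### Components of the associated graph -/

/-- The submixed graph of `G` that underlies the component of `x` in the associated graph. -/
def comp (G : SimpleMixedGraph V) (x : V × Bool) : SimpleMixedGraph V where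
  verts := {v | v ∈ G.verts ∧ ∃ b, G.assoc.Reachable x (v, b)}
  edges := {e | e ∈ G.edges ∧ ∃ b, ∀ v ∈ e, G.assoc.Reachable x (v, b)}
  arcs := {a | a ∈ G.arcs ∧ G.assoc.Reachable x (a.1, false) ∧ G.assoc.Reachable x (a.2, true)}
  edge_mem e he v hv := ⟨G.edge_mem e he.1 v hv, he.2.imp fun _ h => h v hv⟩
  arc_mem a ha := ⟨⟨(G.arc_mem a ha.1).1, _, ha.2.1⟩, ⟨(G.arc_mem a ha.1).2, _, ha.2.2⟩⟩
  edge_loopless e he := G.edge_loopless e he.1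
  arc_loopless a ha := G.arc_loopless a ha.1

theorem comp_le (x : V × Bool) : G.comp x ≤ G := ⟨fun _ h => h.1, fun _ h => h.1, fun _ h => h.1⟩

theorem comp_eq_of_reachable {x y : V × Bool} (h : G.assoc.Reachable x y) :
    G.comp x = G.comp y := by
  have : ∀ z, G.assoc.Reachable x z ↔ G.assoc.Reachable y z :=
    fun z => ⟨fun hz => h.symm.trans hz, fun hz => h.trans hz⟩
  simp only [comp, this]

theorem comp_mem {x y : V × Bool} (h : G.assoc.Reachable x y) (hx : x.1 ∈ G.verts) :
    y.1 ∈ (G.comp x).verts := ⟨assoc_reachable_mem h hx, y.2, h⟩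

theorem mem_comp_edges {x : V × Bool} {u v : V} {b : Bool} (hu : G.assoc.Reachable x (u, b))
    (h : s(u, v) ∈ G.edges) : s(u, v) ∈ (G.comp x).edges := by
  refine ⟨h, b, fun z hz => ?_⟩
  rcases Sym2.mem_iff.1 hz with rfl | rfl
  · exact hu
  · exact hu.trans (SimpleGraph.Adj.reachable (assoc_adj_same.2 h))

theorem mem_comp_arcs {x : V × Bool} {a : V × V} (ha : a ∈ G.arcs)
    (h : G.assoc.Reachable x (a.1, false) ∨ G.assoc.Reachable x (a.2, true)) :
    a ∈ (G.comp x).arcs := by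
  have hadj : G.assoc.Adj (a.1, false) (a.2, true) := assoc_adj_arc.2 ha
  rcases h with h | h
  · exact ⟨ha, h, h.trans hadj.reachable⟩
  · exact ⟨ha, h.trans hadj.symm.reachable, h⟩

theorem comp_adj {x y z : V × Bool} (hy : G.assoc.Reachable x y) :
    (G.comp x).assoc.Adj y z ↔ G.assoc.Adj y z := by
  refine ⟨fun h => assoc_mono (comp_le x) h, fun h => ?_⟩
  rcases y with ⟨y, b⟩
  rcases z with ⟨z, c⟩
  rcases h with ⟨h, h'⟩ | ⟨h, h', h''⟩ | ⟨h, h', h''⟩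
  · exact Or.inl ⟨h, mem_comp_edges hy h'⟩
  · simp only at h h'
    subst h h'
    exact Or.inr (Or.inl ⟨rfl, rfl, mem_comp_arcs h'' (Or.inl hy)⟩)
  · simp only at h h'
    subst h h'
    exact Or.inr (Or.inr ⟨rfl, rfl, mem_comp_arcs h'' (Or.inr hy)⟩)

theorem comp_reachable {x y z : V × Bool} (hy : G.assoc.Reachable x y)
    (hz : G.assoc.Reachable y z) : (G.comp x).assoc.Reachable y z :=
  (SimpleGraph.reachable_mem_of_closed
    (C := {z | G.assoc.Reachable x z ∧ (G.comp x).assoc.Reachable y z})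
    (fun _ hz _ hzw => ⟨hz.1.trans (SimpleGraph.Adj.reachable hzw),
      hz.2.trans (SimpleGraph.Adj.reachable ((comp_adj hz.1).2 hzw))⟩) hz ⟨hy, .refl _⟩).2

theorem exists_odd_closed_walk_of_reachable {v : V} (hv : v ∈ G.verts) (hne : G.arcs.Nonempty)
    (h : G.assoc.Reachable (v, false) (v, true)) :
    ∃ W : G.Walk, W.IsAlternating ∧ W.start = v ∧ W.finish = v ∧ Odd W.arcCount := by
  obtain ⟨W, q, hq, h0, h1, -⟩ := exists_walk_of_reachable h hv
  exact ⟨W, hq.isAlternating hne, by rw [hq.start_eq, h0], by rw [hq.finish_eq, h1],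
    hq.odd_arcCount_iff.2 (by simp [h0, h1])⟩

/-- The lift of a closed walk with an odd number of arcs ends on the other copy of its starting
vertex. -/
theorem reachable_of_odd_closed_walk {v : V} {W : G.Walk} (hW : W.IsAlternating)
    (hs : W.start = v) (hf : W.finish = v) (ho : Odd W.arcCount) :
    G.assoc.Reachable (v, false) (v, true) := by
  obtain ⟨q, hq⟩ := hW.exists_isLift
  have hr := hq.reachable (Nat.zero_le _) le_rfl
  rw [hq.odd_arcCount_iff] at ho
  rw [hq.start_eq] at hs
  rw [hq.finish_eq] at hf
  generalize q 0 = x at *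
  generalize q W.length = y at *
  rcases x with ⟨x, _ | _⟩ <;> rcases y with ⟨y, _ | _⟩ <;> simp at * <;> subst hs hf
  · exact hr
  · exact hr.symm

/-- Any two underlying vertices have copies in the component, and a path between these projects to
an alternating walk. If an undirected component contains both a head and a tail of arcs, its `true`
and its `false` copy both lie in the component, so the two copies of each of its vertices are
joined. -/
theorem isSpecial_comp {x : V × Bool} (hne : (G.comp x).arcs.Nonempty) :
    (G.comp x).IsSpecial := by
  refine ⟨hne, ?_, ?_⟩
  · rintro u ⟨hu, b, hub⟩ v ⟨hv, c, hvc⟩ -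
    obtain ⟨W, q, hq, h0, h1, -⟩ := exists_walk_of_reachable
      (comp_reachable hub (hub.symm.trans hvc)) ⟨hu, b, hub⟩
    exact ⟨W, hq.isAlternating hne, by rw [hq.start_eq, h0], by rw [hq.finish_eq, h1]⟩
  · rintro H hH ⟨v, hv, u, huv⟩ ⟨w, hw, z, hwz⟩ t ht
    have hr : ∀ s ∈ H.verts, ∀ b, (G.comp x).assoc.Reachable (t, b) (s, b) := fun s hs b => by
      have hs' := hs
      rw [hH.eq_undirectedComp ht] at hs'
      exact assoc_reachable_of_toSimpleGraph hs'.2 b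
    have hrG : ∀ s ∈ H.verts, ∀ b, G.assoc.Reachable (t, b) (s, b) := fun s hs b =>
      (hr s hs b).mono (assoc_mono (comp_le x))
    have ht1 : G.assoc.Reachable x (t, true) := huv.2.2.trans (hrG v hv true).symm
    have ht0 : G.assoc.Reachable x (t, false) := hwz.2.1.trans (hrG w hw false).symm
    exact exists_odd_closed_walk_of_reachable (hH.1.1.1 ht) hne
      (comp_reachable ht0 (ht0.symm.trans ht1))

/-- To get from the `true` to the `false` copy, a walk must leave the undirected component of `u` at
the head of an arc. As `u` is a tail, the closed-walk clause of speciality applies to that component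
and joins the two copies of `u`. -/
theorem IsSpecial.reachable_false (hT : T.IsSpecial) {u w y : V} (hu : (u, w) ∈ T.arcs)
    (h : T.assoc.Reachable (u, true) (y, false)) : T.assoc.Reachable (u, true) (u, false) := by
  have huT := (T.arc_mem _ hu).1
  rcases reachable_cases h with ⟨h, -⟩ | ⟨v, z, hv, hadj⟩
  · simp at h
  · have hzv : (z, v) ∈ T.arcs := assoc_adj_arc.1 hadj.symm
    obtain ⟨W, hW, hs, hf, ho⟩ := hT.2.2 (T.undirectedComp u) (isComponent_undirectedComp huT)
      ⟨v, (mem_undirectedComp huT).2 hv, z, hzv⟩ ⟨u, (mem_undirectedComp huT).2 (.refl _), w, hu⟩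
      u ((mem_undirectedComp huT).2 (.refl _))
    exact (reachable_of_odd_closed_walk hW hs hf ho).symm

/-- A special submixed graph sits inside one component of `assoc`, that of the tail copy of any of
its arcs. With `isSpecial_comp` this identifies the maximal special submixed graphs. -/
theorem IsSpecial.le_comp (hT : T.IsSpecial) (hle : T ≤ G) {a : V × V} (ha : a ∈ T.arcs) :
    T ≤ G.comp (a.1, false) := by
  have haT := (T.arc_mem _ ha).1
  have hv : ∀ u ∈ T.verts, ∃ b, T.assoc.Reachable (a.1, false) (u, b) := by
    intro u hu
    by_cases hua : a.1 = u
    · exact ⟨false, by rw [hua]⟩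
    obtain ⟨W, hW, hs, hf⟩ := hT.2.1 a.1 haT u hu hua
    obtain ⟨q, hq⟩ := hW.exists_isLift
    have hr := hq.reachable (Nat.zero_le _) le_rfl
    rw [hq.start_eq] at hs
    rw [hq.finish_eq] at hf
    generalize q 0 = x at *
    generalize q W.length = y at *
    rcases x with ⟨x, b⟩
    rcases y with ⟨y, c⟩
    simp only at hs hf
    subst hs hf
    cases b
    · exact ⟨c, hr⟩
    -- The lift starts on the wrong copy. Either the target is reached by edges alone, which can be
    -- repeated on the `false` copy, or an arc is available and `reachable_false` joins the two
    -- copies.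
    · rcases reachable_cases hr with ⟨-, h⟩ | ⟨v, z, hv, hadj⟩
      · exact ⟨false, assoc_reachable_of_toSimpleGraph h false⟩
      · exact ⟨c, (hT.reachable_false ha ((assoc_reachable_of_toSimpleGraph hv true).trans
          hadj.reachable)).symm.trans hr⟩
  have hc : ∀ c ∈ T.arcs, T.assoc.Reachable (a.1, false) (c.1, false) := by
    intro c hcT
    obtain ⟨b, hb⟩ := hv c.1 (T.arc_mem _ hcT).1
    cases b
    · exact hb
    · exact hb.trans (hT.reachable_false hcT hb.symm)
  have hm := assoc_mono hle
  refine ⟨fun u hu => ⟨hle.1 hu, ?_⟩, fun e he => ?_, fun c hcT => ?_⟩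
  · obtain ⟨b, hb⟩ := hv u hu
    exact ⟨b, hb.mono hm⟩
  · induction e with | _ u v
    obtain ⟨b, hb⟩ := hv u (T.edge_mem _ he _ (by simp))
    exact mem_comp_edges (hb.mono hm) (hle.2.1 he)
  · exact mem_comp_arcs (hle.2.2 hcT) (Or.inl ((hc c hcT).mono hm))

theorem isMaximalSpecial_comp {x : V × Bool} (hne : (G.comp x).arcs.Nonempty) :
    (G.comp x).IsMaximalSpecial G := by
  refine ⟨⟨comp_le x, isSpecial_comp hne⟩, fun T hT hle => ?_⟩
  obtain ⟨a, ha⟩ := hne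
  rw [comp_eq_of_reachable ha.2.1]
  exact hT.2.le_comp hT.1 (hle.2.2 ha)

theorem IsMaximalSpecial.exists_eq_comp (h : H.IsMaximalSpecial G) :
    ∃ x : V × Bool, x.1 ∈ G.verts ∧ (G.comp x).arcs.Nonempty ∧ H = G.comp x := by
  obtain ⟨a, ha⟩ := h.1.2.1
  have hle := h.1.2.le_comp h.1.1 ha
  have hne : (G.comp (a.1, false)).arcs.Nonempty := ⟨a, hle.2.2 ha⟩
  exact ⟨(a.1, false), h.1.1.1 (H.arc_mem a ha).1, hne,
    le_antisymm' hle (h.2 ⟨comp_le _, isSpecial_comp hne⟩ hle)⟩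

/-- A component of the associated graph that meets no arc is a copy of a component of the
undirected part. -/
theorem comp_no_arc {u : V} {b : Bool} (h : ¬ (G.comp (u, b)).arcs.Nonempty) {v w : V}
    (hv : G.toSimpleGraph.Reachable u v) : ¬ G.assoc.Adj (v, b) (w, !b) := by
  intro hadj
  have hr := assoc_reachable_of_toSimpleGraph hv b
  cases b
  · exact h ⟨(v, w), mem_comp_arcs (assoc_adj_arc.1 hadj) (Or.inl hr)⟩
  · exact h ⟨(w, v), mem_comp_arcs (assoc_adj_arc.1 hadj.symm) (Or.inr hr)⟩

theorem reachable_iff_of_no_arc {u : V} {b : Bool}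
    (h : ∀ v w, G.toSimpleGraph.Reachable u v → ¬ G.assoc.Adj (v, b) (w, !b)) {z : V × Bool} :
    G.assoc.Reachable (u, b) z ↔ z.2 = b ∧ G.toSimpleGraph.Reachable u z.1 := by
  constructor
  · intro hz
    rcases reachable_cases hz with hz | ⟨v, w, hv, hadj⟩
    · exact hz
    · exact absurd hadj (h v w hv)
  · rcases z with ⟨z, c⟩
    rintro ⟨rfl, hz⟩
    exact assoc_reachable_of_toSimpleGraph hz _

/-- Arcs leave the `false` copies and enter the `true` copies, so the bit decides between the first
and the second kind. An undirected component that meets no arc gives two components of `assoc`,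
which is why it counts twice. -/
theorem undirectedComp_isMixed {u : V} {b : Bool} (hu : u ∈ G.verts)
    (h : ¬ (G.comp (u, b)).arcs.Nonempty) :
    (b = false ∧ (G.undirectedComp u).IsOutFreeComponent G) ∨
      (b = true ∧ (G.undirectedComp u).IsInFreeComponent G) := by
  cases b
  · refine Or.inl ⟨rfl, isComponent_undirectedComp hu, fun v hv w hvw => ?_⟩
    exact comp_no_arc h ((mem_undirectedComp hu).1 hv) (assoc_adj_arc.2 hvw)
  · refine Or.inr ⟨rfl, isComponent_undirectedComp hu, fun v hv w hvw => ?_⟩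
    exact comp_no_arc h ((mem_undirectedComp hu).1 hv) (assoc_adj_arc.2 hvw).symm

/-- Each component of `assoc` gives an element of `MixedComponents`, and different components give
different elements: equal special submixed graphs share an arc, whose tail copy lies in both
components; in the arcless cases the summand fixes the bit and the submixed graph fixes the
undirected component. -/
theorem Uniconnected.reachable (h : G.Uniconnected) {x y : V × Bool} (hx : x.1 ∈ G.verts)
    (hy : y.1 ∈ G.verts) : G.assoc.Reachable x y := by
  have hsub : Subsingleton ({H : SimpleMixedGraph V // H.IsOutFreeComponent G} ⊕
      {H : SimpleMixedGraph V // H.IsInFreeComponent G} ⊕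
      {H : SimpleMixedGraph V // H.IsMaximalSpecial G}) := (Nat.card_eq_one_iff_unique.1 h).1
  rcases x with ⟨u, b⟩
  rcases y with ⟨v, c⟩
  by_cases hxa : (G.comp (u, b)).arcs.Nonempty <;> by_cases hya : (G.comp (v, c)).arcs.Nonempty
  · have := hsub.elim (Sum.inr (Sum.inr ⟨_, isMaximalSpecial_comp hxa⟩))
      (Sum.inr (Sum.inr ⟨_, isMaximalSpecial_comp hya⟩))
    simp only [Sum.inr.injEq, Subtype.mk.injEq] at this
    obtain ⟨a, ha⟩ := hxa
    have ha' := ha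
    rw [this] at ha'
    exact ha.2.1.trans ha'.2.1.symm
  · rcases undirectedComp_isMixed hy hya with ⟨-, h'⟩ | ⟨-, h'⟩
    · have := hsub.elim (Sum.inr (Sum.inr ⟨_, isMaximalSpecial_comp hxa⟩)) (Sum.inl ⟨_, h'⟩)
      simp at this
    · have := hsub.elim (Sum.inr (Sum.inr ⟨_, isMaximalSpecial_comp hxa⟩))
        (Sum.inr (Sum.inl ⟨_, h'⟩))
      simp at this
  · rcases undirectedComp_isMixed hx hxa with ⟨-, h'⟩ | ⟨-, h'⟩
    · have := hsub.elim (Sum.inr (Sum.inr ⟨_, isMaximalSpecial_comp hya⟩)) (Sum.inl ⟨_, h'⟩)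
      simp at this
    · have := hsub.elim (Sum.inr (Sum.inr ⟨_, isMaximalSpecial_comp hya⟩))
        (Sum.inr (Sum.inl ⟨_, h'⟩))
      simp at this
  · have key : b = c ∧ G.undirectedComp u = G.undirectedComp v := by
      rcases undirectedComp_isMixed hx hxa with ⟨rfl, h'⟩ | ⟨rfl, h'⟩ <;>
        rcases undirectedComp_isMixed hy hya with ⟨rfl, h''⟩ | ⟨rfl, h''⟩
      · simpa using hsub.elim (Sum.inl ⟨_, h'⟩) (Sum.inl ⟨_, h''⟩)
      · simpa using hsub.elim (Sum.inl ⟨_, h'⟩) (Sum.inr (Sum.inl ⟨_, h''⟩))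
      · simpa using hsub.elim (Sum.inr (Sum.inl ⟨_, h'⟩)) (Sum.inl ⟨_, h''⟩)
      · simpa using hsub.elim (Sum.inr (Sum.inl ⟨_, h'⟩)) (Sum.inr (Sum.inl ⟨_, h''⟩))
    obtain ⟨rfl, hE⟩ := key
    refine assoc_reachable_of_toSimpleGraph ((mem_undirectedComp hx).1 ?_) b
    rw [hE, mem_undirectedComp hy]

end SimpleMixedGraph

/-! ### The AP property and path components of the associated graph -/

theorem Set.ncard_bool_eq_two_iff (S : Set Bool) : S.ncard = 2 ↔ ∀ b, b ∈ S := by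
  rw [← Set.eq_univ_iff_forall]
  constructor
  · intro h
    exact Set.eq_of_subset_of_ncard_le (Set.subset_univ S) (by simp [h])
  · rintro rfl
    simp

theorem Set.one_le_ncard_bool_iff (S : Set Bool) : 1 ≤ S.ncard ↔ ∃ b, b ∈ S := by
  rw [Nat.one_le_iff_ne_zero, ← Nat.pos_iff_ne_zero, Set.ncard_pos]
  rfl

namespace SimpleGraph

variable {X : Type*} {K : SimpleGraph X} {C : Set X} {m : ℕ} {p : ℕ → X}

theorem IsPathEnum.exists_step (h : K.IsPathEnum C m p) {x y : X} (hx : x ∈ C) (hy : y ∈ C)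
    (hxy : K.Adj x y) : ∃ i < m, s(p i, p (i + 1)) = s(x, y) := by
  obtain ⟨i, hi, rfl⟩ := (h.mem_iff x).1 hx
  obtain ⟨j, hj, rfl⟩ := (h.mem_iff y).1 hy
  rcases (h.adj_iff i hi j hj).1 hxy with rfl | rfl
  · exact ⟨i, by omega, rfl⟩
  · exact ⟨j, by omega, Sym2.eq_swap⟩

/-- The new path is `p c` followed by the segment from `p s` to `p l`, which does not contain `p c`.
-/
theorem exists_path_cons (hadj : ∀ i < m, K.Adj (p i) (p (i + 1)))
    (hinj : ∀ i ≤ m, ∀ j ≤ m, p i = p j → i = j) {c s l k : ℕ} (hc : c ≤ m) (hl : l ≤ m)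
    (hsl : c < s ∨ l < c) (hcs : K.Adj (p c) (p s)) (hsk : s ≤ k) (hkl : k < l) :
    ∃ (m' : ℕ) (p' : ℕ → X), (∀ i < m', K.Adj (p' i) (p' (i + 1))) ∧
      (∀ i ≤ m', ∀ j ≤ m', p' i = p' j → i = j) ∧
      (∃ t < m', s(p' t, p' (t + 1)) = s(p c, p s)) ∧
      ∃ t < m', s(p' t, p' (t + 1)) = s(p k, p (k + 1)) := by
  refine ⟨l - s + 1, fun t => if t = 0 then p c else p (s + (t - 1)), ?_, ?_, ⟨0, by omega, by simp⟩,
    ⟨k - s + 1, by omega, ?_⟩⟩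
  · intro i hi
    rcases Nat.eq_zero_or_pos i with rfl | h
    · simpa using hcs
    · have h1 : i ≠ 0 := by omega
      have h2 : s + (i + 1 - 1) = s + (i - 1) + 1 := by omega
      simp only [h1, if_false, Nat.succ_ne_zero, h2]
      exact hadj _ (by omega)
  · intro i hi j hj h
    simp only at h
    split_ifs at h with h1 h2 h2
    · omega
    · have := hinj _ (by omega) _ (by omega) h
      omega
    · have := hinj _ (by omega) _ (by omega) h
      omega
    · have := hinj _ (by omega) _ (by omega) h
      omega
  · have h1 : s + (k - s + 1 - 1) = k := by omega
    have h2 : s + (k - s + 1 + 1 - 1) = k + 1 := by omega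
    simp only [Nat.succ_ne_zero, if_false, h1, h2]

theorem exists_path_snoc (hadj : ∀ i < m, K.Adj (p i) (p (i + 1)))
    (hinj : ∀ i ≤ m, ∀ j ≤ m, p i = p j → i = j) {c s l k : ℕ} (hc : c ≤ m) (hl : l ≤ m)
    (hsl : c < s ∨ l < c) (hcs : K.Adj (p l) (p c)) (hsk : s ≤ k) (hkl : k < l) :
    ∃ (m' : ℕ) (p' : ℕ → X), (∀ i < m', K.Adj (p' i) (p' (i + 1))) ∧
      (∀ i ≤ m', ∀ j ≤ m', p' i = p' j → i = j) ∧
      (∃ t < m', s(p' t, p' (t + 1)) = s(p l, p c)) ∧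
      ∃ t < m', s(p' t, p' (t + 1)) = s(p k, p (k + 1)) := by
  have h0 : s + (l - s) = l := by omega
  refine ⟨l - s + 1, fun t => if t ≤ l - s then p (s + t) else p c, ?_, ?_,
    ⟨l - s, by omega, by simp [h0]⟩, ⟨k - s, by omega, ?_⟩⟩
  · intro i hi
    rcases (show i < l - s ∨ i = l - s by omega) with h | rfl
    · simp only [h.le, Nat.succ_le_of_lt h, if_true]
      exact hadj _ (by omega)
    · simpa [h0] using hcs
  · intro i hi j hj h
    simp only at h
    split_ifs at h with h1 h2 h2
    · have := hinj _ (by omega) _ (by omega) h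
      omega
    · have := hinj _ (by omega) _ (by omega) h
      omega
    · have := hinj _ (by omega) _ (by omega) h
      omega
    · omega
  · have h1 : k - s ≤ l - s := by omega
    have h2 : k - s + 1 ≤ l - s := by omega
    have h3 : s + (k - s) = k := by omega
    have h4 : s + (k - s + 1) = k + 1 := by omega
    simp only [h1, h2, if_true, h3, h4]

/-- A path with a chord: some path contains both the chord and a given edge of the path. -/
theorem exists_path_of_chord (hadj : ∀ i < m, K.Adj (p i) (p (i + 1)))
    (hinj : ∀ i ≤ m, ∀ j ≤ m, p i = p j → i = j) {i j k : ℕ} (hij : i + 1 < j) (hj : j ≤ m)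
    (hk : k < m) (hchord : K.Adj (p i) (p j)) :
    ∃ (m' : ℕ) (p' : ℕ → X), (∀ i < m', K.Adj (p' i) (p' (i + 1))) ∧
      (∀ i ≤ m', ∀ j ≤ m', p' i = p' j → i = j) ∧
      (∃ t < m', s(p' t, p' (t + 1)) = s(p i, p j)) ∧
      ∃ t < m', s(p' t, p' (t + 1)) = s(p k, p (k + 1)) := by
  -- The chord closes the segment from `i` to `j` to a cycle. An edge before or after the cycle is
  -- reached by shortcutting along the chord; an edge on the cycle survives when the cycle is opened
  -- at another edge, the last one if `k + 1 < j` and the first one if `k + 1 = j`.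
  rcases Nat.lt_or_ge k i with h | h
  · exact exists_path_snoc hadj hinj (c := j) (s := 0) (l := i) hj (by omega) (by omega) hchord
      (by omega) h
  rcases Nat.lt_or_ge k j with h' | h'
  · rcases Nat.lt_or_ge (k + 1) j with h'' | h''
    · rw [Sym2.eq_swap (a := p i)]
      exact exists_path_cons hadj hinj (c := j) (s := i) (l := j - 1) hj (by omega) (by omega)
        hchord.symm h (by omega)
    · rw [Sym2.eq_swap (a := p i)]
      exact exists_path_snoc hadj hinj (c := i) (s := i + 1) (l := j) (by omega) hj (by omega)
        hchord.symm (by omega) h'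
  · exact exists_path_cons hadj hinj (c := i) (s := j) (l := m) (by omega) le_rfl (by omega)
      hchord h' hk

end SimpleGraph

namespace SimpleMixedGraph

variable {V : Type*} {G H : SimpleMixedGraph V} {x : V × Bool}

theorem reachable_of_comp {y z : V × Bool} (hy : G.assoc.Reachable x y)
    (h : (G.comp x).assoc.Reachable y z) : G.assoc.Reachable x z :=
  hy.trans (h.mono (assoc_mono (comp_le x)))

theorem exists_mem_of_mem_comp_edges {u v : V} (h : s(u, v) ∈ (G.comp x).edges) :
    ∃ b, G.assoc.Reachable x (u, b) ∧ G.assoc.Reachable x (v, b) :=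
  h.2.imp fun _ hb => ⟨hb u (by simp), hb v (by simp)⟩

/-- A path between the two copies of `v` projects to an alternating path that contains `v` twice. -/
theorem mem_twiceVerts_iff (hne : H.arcs.Nonempty) {v : V} (hv : v ∈ H.verts) :
    v ∈ H.twiceVerts ↔ H.assoc.Reachable (v, false) (v, true) := by
  constructor
  · rintro ⟨-, W, hW, hc⟩
    obtain ⟨q, hq⟩ := hW.1.exists_isLift
    have hinj := (hq.isAlternatingPath_iff hne).1 hW
    rw [hq.vertCount_eq hinj, Set.ncard_bool_eq_two_iff] at hc
    obtain ⟨i, hi, h0⟩ := hc false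
    obtain ⟨j, hj, h1⟩ := hc true
    rw [← h0, ← h1]
    exact hq.reachable hi hj
  · intro h
    obtain ⟨W, q, hq, h0, h1, hinj⟩ := exists_walk_of_reachable h hv
    refine ⟨hv, W, (hq.isAlternatingPath_iff hne).2 hinj, ?_⟩
    rw [hq.vertCount_eq hinj, Set.ncard_bool_eq_two_iff]
    rintro (_ | _)
    · exact ⟨0, Nat.zero_le _, h0⟩
    · exact ⟨_, le_rfl, h1⟩

theorem reachable_of_mem_twiceEdges (hne : H.arcs.Nonempty) {u v : V}
    (h : s(u, v) ∈ H.twiceEdges) : H.assoc.Reachable (u, false) (u, true) := by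
  obtain ⟨-, W, hW, hc⟩ := h
  obtain ⟨q, hq⟩ := hW.1.exists_isLift
  have htr := Walk.IsLift.trail_of_inj ((hq.isAlternatingPath_iff hne).1 hW)
  rw [hq.edgeCount_eq htr, Set.ncard_bool_eq_two_iff] at hc
  have key : ∀ b, ∃ i ≤ W.length, q i = (u, b) := fun b => by
    obtain ⟨i, hi, he⟩ := hc b
    rcases Sym2.eq_iff.1 he with ⟨h1, -⟩ | ⟨-, h1⟩
    · exact ⟨i, hi.le, h1⟩
    · exact ⟨i + 1, hi, h1⟩
  obtain ⟨i, hi, h0⟩ := key false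
  obtain ⟨j, hj, h1⟩ := key true
  rw [← h0, ← h1]
  exact hq.reachable hi hj

theorem reachable_both {v : V} {b : Bool} (hb : G.assoc.Reachable x (v, b))
    (h : (G.comp x).assoc.Reachable (v, false) (v, true)) (c : Bool) :
    G.assoc.Reachable x (v, c) := by
  cases b <;> cases c
  · exact hb
  · exact reachable_of_comp hb h
  · exact reachable_of_comp hb h.symm
  · exact hb

/-- The projection of the whole path is the required alternating path. It passes through everything
in the component; if it meets a vertex or an edge twice, it is itself a witness that this is
possible. -/
theorem hasAPProperty_comp_of_isPathEnum (hx : x.1 ∈ G.verts) (hne : (G.comp x).arcs.Nonempty)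
    {m : ℕ} {p : ℕ → V × Bool} (hp : G.assoc.IsPathEnum {y | G.assoc.Reachable x y} m p) :
    (G.comp x).HasAPProperty := by
  have hC : ∀ i ≤ m, G.assoc.Reachable x (p i) := fun i hi => (hp.mem_iff _).2 ⟨i, hi, rfl⟩
  have hadj : ∀ i < m, (G.comp x).assoc.Adj (p i) (p (i + 1)) := fun i hi =>
    (comp_adj (hC i hi.le)).2 ((hp.adj_iff i hi.le (i + 1) hi).2 (Or.inl rfl))
  obtain ⟨W, rfl, hq⟩ : ∃ W : (G.comp x).Walk, W.length = m ∧ W.IsLift p :=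
    ⟨Walk.ofSeq m p hadj (comp_mem (hC 0 (Nat.zero_le _)) hx), rfl, Walk.isLift_ofSeq _ _ _ _⟩
  have hW := (hq.isAlternatingPath_iff hne).2 hp.inj
  have htr := Walk.IsLift.trail_of_inj hp.inj
  refine Or.inr ⟨W, hW, fun v hv => ?_, fun a ha => ?_, fun e he => ?_⟩
  · obtain ⟨b, hb⟩ := hv.2
    have h1 : 1 ≤ W.vertCount v := by
      rw [hq.vertCount_eq hp.inj, Set.one_le_ncard_bool_iff]
      exact ⟨b, (hp.mem_iff _).1 hb⟩
    split_ifs with h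
    · rw [hq.vertCount_eq hp.inj, Set.ncard_bool_eq_two_iff]
      exact fun c => (hp.mem_iff _).1 (reachable_both hb ((mem_twiceVerts_iff hne hv).1 h) c)
    · have h2 : W.vertCount v ≤ 2 := hW.2.1.1 v
      have h3 : W.vertCount v ≠ 2 := fun h' => h ⟨hv, W, hW, h'⟩
      omega
  · rw [hq.arcOccurrences_pos_iff]
    exact hp.exists_step ha.2.1 ha.2.2 (assoc_adj_arc.2 ha.1)
  · induction e with | _ u v
    have hstep : ∀ c, G.assoc.Reachable x (u, c) →
        ∃ i < W.length, s(p i, p (i + 1)) = s((u, c), (v, c)) := fun c hc =>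
      hp.exists_step hc (hc.trans (SimpleGraph.Adj.reachable (assoc_adj_same.2 he.1)))
        (assoc_adj_same.2 he.1)
    obtain ⟨b, hb, -⟩ := exists_mem_of_mem_comp_edges he
    have h1 : 1 ≤ W.edgeCount s(u, v) := by
      rw [hq.edgeCount_eq htr, Set.one_le_ncard_bool_iff]
      exact ⟨b, hstep b hb⟩
    split_ifs with h
    · rw [hq.edgeCount_eq htr, Set.ncard_bool_eq_two_iff]
      exact fun c => hstep c (reachable_both hb (reachable_of_mem_twiceEdges hne h) c)
    · have h2 : W.edgeCount s(u, v) ≤ 2 := hW.2.2.1.1 _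
      have h3 : W.edgeCount s(u, v) ≠ 2 := fun h' => h ⟨he, W, hW, h'⟩
      omega

open Classical in
/-- An edge of the component that joins two vertices of an alternating path as in the associated
path property is traversed by that path. -/
theorem succ_eq_of_adj_of_covers (hne : (G.comp x).arcs.Nonempty)
    {W : (G.comp x).Walk} {q : ℕ → V × Bool} (hq : W.IsLift q)
    (hinj : ∀ i ≤ W.length, ∀ j ≤ W.length, q i = q j → i = j)
    (harc : ∀ a ∈ (G.comp x).arcs, 1 ≤ W.arcOccurrences a)
    (hedge : ∀ e ∈ (G.comp x).edges, W.edgeCount e = if e ∈ (G.comp x).twiceEdges then 2 else 1)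
    (hC : ∀ i ≤ W.length, G.assoc.Reachable x (q i)) :
    ∀ i ≤ W.length, ∀ j ≤ W.length, i < j → G.assoc.Adj (q i) (q j) → i + 1 = j := by
  have htr := Walk.IsLift.trail_of_inj hinj
  intro i hi j hj hij hadj
  by_contra hne'
  have hadjH := (comp_adj (hC i hi)).2 hadj
  have hno : ¬ ∃ k < W.length, s(q k, q (k + 1)) = s(q i, q j) := by
    rintro ⟨k, hk, he⟩
    rcases Sym2.eq_iff.1 he with ⟨h1, h2⟩ | ⟨h1, h2⟩
    · have := hinj _ hk.le _ hi h1
      have := hinj _ hk _ hj h2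
      omega
    · have := hinj _ hk.le _ hj h1
      have := hinj _ hk _ hi h2
      omega
  obtain ⟨u, b, hub⟩ : ∃ u b, q i = (u, b) := ⟨_, _, rfl⟩
  obtain ⟨v, c, hvc⟩ : ∃ v c, q j = (v, c) := ⟨_, _, rfl⟩
  rw [hub, hvc] at hno hadjH
  -- A chord within one copy lies over an edge of `G` whose lift in this copy is not traversed, so
  -- its count is one and its other lift is traversed. Some path contains the chord and that other
  -- lift, so the edge should have been counted twice.
  by_cases hbc : b = c
  · subst hbc
    have he : s(u, v) ∈ (G.comp x).edges := assoc_adj_same.1 hadjH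
    have hmem : s(u, v) ∉ (G.comp x).twiceEdges := fun ht => by
      have := hedge _ he
      rw [if_pos ht, hq.edgeCount_eq htr, Set.ncard_bool_eq_two_iff] at this
      exact hno (this b)
    have hone := hedge _ he
    rw [if_neg hmem, hq.edgeCount_eq htr] at hone
    obtain ⟨d, k, hk, hke⟩ := (Set.one_le_ncard_bool_iff _).1 hone.ge
    have hdb : d ≠ b := by
      rintro rfl
      exact hno ⟨k, hk, hke⟩
    obtain ⟨m', p', hadj', hinj', h1, h2⟩ := SimpleGraph.exists_path_of_chord
      (K := (G.comp x).assoc) (p := q) (fun t ht => hq.adj ht) hinj (show i + 1 < j by omega) hj hk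
      (by rw [hub, hvc]; exact hadjH)
    rw [hub, hvc] at h1
    rw [hke] at h2
    have h0 : (p' 0).1 ∈ (G.comp x).verts := by
      obtain ⟨t, ht, -⟩ := h1
      exact (assoc_adj_mem (hadj' 0 (by omega))).1
    obtain ⟨W', rfl, hq'⟩ : ∃ W : (G.comp x).Walk, W.length = m' ∧ W.IsLift p' :=
      ⟨Walk.ofSeq m' p' hadj' h0, rfl, Walk.isLift_ofSeq _ _ _ _⟩
    refine hmem ⟨he, W', (hq'.isAlternatingPath_iff hne).2 hinj', ?_⟩
    rw [hq'.edgeCount_eq (Walk.IsLift.trail_of_inj hinj'), Set.ncard_bool_eq_two_iff]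
    intro f
    by_cases hf : f = b
    · subst hf; exact h1
    · obtain rfl : f = d :=
        (by decide : ∀ f d b : Bool, f ≠ b → d ≠ b → f = d) f d b hf hdb
      exact h2
  -- A chord between the copies is the only lift of its arc, hence is traversed because all arcs are
  -- covered.
  · have key : ∀ u v : V, s((u, false), (v, true)) = s(q i, q j) → (u, v) ∈ (G.comp x).arcs →
        False := fun u v he ha => hno (by
      obtain ⟨k, hk, hke⟩ := (hq.arcOccurrences_pos_iff _).1 (harc _ ha)
      exact ⟨k, hk, by rw [hke, he, hub, hvc]⟩)
    cases b <;> cases c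
    · exact hbc rfl
    · exact key u v (by rw [hub, hvc]) (assoc_adj_arc.1 hadjH)
    · exact key v u (by rw [hub, hvc]; exact Sym2.eq_swap) (assoc_adj_arc.1 hadjH.symm)
    · exact hbc rfl

/-- The lift of the given alternating path has no chords and misses no vertex of the component: if
one copy of `v` were missed, the other would be visited, both would lie in the component, and `v`
would have to be visited twice. -/
theorem exists_isPathEnum_of_hasAPProperty_comp (hne : (G.comp x).arcs.Nonempty)
    (h : (G.comp x).HasAPProperty) :
    ∃ m p, G.assoc.IsPathEnum {y | G.assoc.Reachable x y} m p := by
  rcases h with h | ⟨W, hW, hvert, harc, hedge⟩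
  · exact absurd h.1 hne.ne_empty
  obtain ⟨q, hq⟩ := hW.1.exists_isLift
  have hinj := (hq.isAlternatingPath_iff hne).1 hW
  have hC : ∀ i ≤ W.length, G.assoc.Reachable x (q i) := by
    -- A traversed arc has a unique lift, which places the lift of `W` in the component of `x`.
    obtain ⟨a, ha⟩ := hne
    obtain ⟨k, hk, he⟩ := (hq.arcOccurrences_pos_iff a).1 (harc a ha)
    have hk' : G.assoc.Reachable x (q k) := by
      rcases Sym2.eq_iff.1 he with ⟨h1, -⟩ | ⟨h1, -⟩
      · rw [h1]; exact ha.2.1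
      · rw [h1]; exact ha.2.2
    exact fun i hi => reachable_of_comp hk' (hq.reachable hk.le hi)
  have hstep := succ_eq_of_adj_of_covers hne hq hinj harc hedge hC
  refine ⟨W.length, q, hinj, fun y => ⟨fun hy => ?_, ?_⟩, fun i hi j hj => ⟨fun hadj => ?_, ?_⟩⟩
  · rcases y with ⟨v, b⟩
    by_cases hx : v ∈ (G.comp x).verts
    · have hc := hvert v hx
      rw [hq.vertCount_eq hinj] at hc
      split_ifs at hc with ht
      · exact (Set.ncard_bool_eq_two_iff _).1 hc b
      · obtain ⟨c, i, hi, hci⟩ := (Set.one_le_ncard_bool_iff _).1 hc.ge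
        by_cases hcb : c = b
        · exact ⟨i, hi, by rw [hci, hcb]⟩
        · have h' := hC i hi
          rw [hci] at h'
          refine absurd ((mem_twiceVerts_iff hne hx).2 ?_) ht
          cases b <;> cases c
          · exact absurd rfl hcb
          · exact comp_reachable hy (SimpleGraph.Reachable.trans (SimpleGraph.Reachable.symm hy) h')
          · exact comp_reachable h' (h'.symm.trans hy)
          · exact absurd rfl hcb
    · obtain ⟨a, ha⟩ := hne
      exact absurd ⟨assoc_reachable_mem (ha.2.1.symm.trans hy) (G.arc_mem _ ha.1).1, b, hy⟩ hx
  · rintro ⟨i, hi, rfl⟩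
    exact hC i hi
  · rcases lt_trichotomy i j with h | h | h
    · exact Or.inl (hstep i hi j hj h hadj)
    · subst h; exact absurd rfl hadj.ne
    · exact Or.inr (hstep j hj i hi h hadj.symm)
  · rintro (rfl | rfl)
    · exact assoc_mono (comp_le x) (hq.adj (by omega))
    · exact (assoc_mono (comp_le x) (hq.adj (by omega))).symm

theorem hasAPProperty_comp_iff (hx : x.1 ∈ G.verts) (hne : (G.comp x).arcs.Nonempty) :
    (G.comp x).HasAPProperty ↔ ∃ m p, G.assoc.IsPathEnum {y | G.assoc.Reachable x y} m p :=
  ⟨exists_isPathEnum_of_hasAPProperty_comp hne,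
    fun ⟨_, _, hp⟩ => hasAPProperty_comp_of_isPathEnum hx hne hp⟩

theorem hasAPProperty_iff_isPath_of_arcs_eq_empty (h : H.arcs = ∅) :
    H.HasAPProperty ↔ H.IsPath := by
  refine ⟨fun h' => h'.resolve_right ?_, Or.inl⟩
  rintro ⟨W, hW, -⟩
  exact hW.1.1.ne_empty h

theorem hasAPProperty_undirectedComp_iff {u : V} {b : Bool} (hu : u ∈ G.verts)
    (h : ∀ v w, G.toSimpleGraph.Reachable u v → ¬ G.assoc.Adj (v, b) (w, !b)) :
    (G.undirectedComp u).HasAPProperty ↔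
      ∃ m p, G.assoc.IsPathEnum {y | G.assoc.Reachable (u, b) y} m p := by
  rw [hasAPProperty_iff_isPath_of_arcs_eq_empty rfl]
  have hadj : ∀ v w, G.toSimpleGraph.Reachable u v →
      (s(v, w) ∈ (G.undirectedComp u).edges ↔ G.assoc.Adj (v, b) (w, b)) := fun v w hv => by
    rw [mem_undirectedComp_edges hv, assoc_adj_same]
  constructor
  · rintro ⟨-, m, ⟨φ⟩⟩
    have hval : ∀ i ≤ m, min i m = i := fun i hi => min_eq_left hi
    have hr : ∀ i, G.toSimpleGraph.Reachable u (φ i).1 := fun i =>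
      (mem_undirectedComp hu).1 (φ i).2
    refine ⟨m, fun i => ((φ ⟨min i m, by omega⟩).1, b), fun i hi j hj he => ?_, fun y => ?_,
      fun i hi j hj => ?_⟩
    · simp only [Prod.mk.injEq, and_true] at he
      have := congrArg Fin.val (φ.injective (Subtype.ext he))
      simp only at this
      omega
    · rw [Set.mem_ofPred_eq, reachable_iff_of_no_arc h]
      constructor
      · rcases y with ⟨y, c⟩
        rintro ⟨rfl, hy⟩
        obtain ⟨i, hi⟩ := φ.surjective ⟨y, (mem_undirectedComp hu).2 hy⟩
        refine ⟨i, Nat.lt_succ_iff.1 i.2, ?_⟩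
        have : (⟨min (i : ℕ) m, by omega⟩ : Fin (m + 1)) = i := Fin.ext (by simp; omega)
        rw [this, hi]
      · rintro ⟨i, hi, rfl⟩
        exact ⟨rfl, hr _⟩
    · rw [← hadj _ _ (hr _)]
      change (G.undirectedComp u).edgeGraph.Adj _ _ ↔ _
      rw [φ.map_adj_iff, SimpleGraph.pathGraph_adj]
      simp only [hval i hi, hval j hj]
  · rintro ⟨m, p, hp⟩
    have hr : ∀ i ≤ m, (p i).2 = b ∧ G.toSimpleGraph.Reachable u (p i).1 := fun i hi =>
      (reachable_iff_of_no_arc h).1 ((hp.mem_iff _).2 ⟨i, hi, rfl⟩)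
    have hp' : ∀ i ≤ m, p i = ((p i).1, b) := fun i hi => Prod.ext rfl (hr i hi).1
    let f : Fin (m + 1) → (G.undirectedComp u).verts := fun i =>
      ⟨(p i).1, (mem_undirectedComp hu).2 (hr i (Nat.lt_succ_iff.1 i.2)).2⟩
    have hf : Function.Bijective f := by
      constructor
      · intro i j hij
        have hi := Nat.lt_succ_iff.1 i.2
        have hj := Nat.lt_succ_iff.1 j.2
        refine Fin.ext (hp.inj i hi j hj ?_)
        rw [hp' i hi, hp' j hj, show (p i).1 = (p j).1 from congrArg Subtype.val hij]
      · rintro ⟨v, hv⟩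
        obtain ⟨i, hi, he⟩ := (hp.mem_iff (v, b)).1
          (assoc_reachable_of_toSimpleGraph ((mem_undirectedComp hu).1 hv) b)
        exact ⟨⟨i, by omega⟩, Subtype.ext (by simp [f, he])⟩
    refine ⟨rfl, m, ⟨⟨Equiv.ofBijective f hf, fun {i j} => ?_⟩⟩⟩
    have hi := Nat.lt_succ_iff.1 i.2
    have hj := Nat.lt_succ_iff.1 j.2
    change s((p i).1, (p j).1) ∈ (G.undirectedComp u).edges ↔ _
    rw [hadj _ _ (hr i hi).2, ← hp' i hi, ← hp' j hj, hp.adj_iff i hi j hj,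
      SimpleGraph.pathGraph_adj]

/-- Each mixed component has the associated path property exactly when each component of the
associated graph is a path. -/
theorem forall_hasAPProperty_iff :
    (∀ H : SimpleMixedGraph V, H.IsMixedComponent G → H.HasAPProperty) ↔
      ∀ x : V × Bool, x.1 ∈ G.verts →
        ∃ m p, G.assoc.IsPathEnum {y | G.assoc.Reachable x y} m p := by
  constructor
  · rintro h ⟨u, b⟩ hu
    by_cases hne : (G.comp (u, b)).arcs.Nonempty
    · exact (hasAPProperty_comp_iff hu hne).1 (h _ (Or.inr (Or.inr (isMaximalSpecial_comp hne))))
    · refine (hasAPProperty_undirectedComp_iff hu fun v w hv => comp_no_arc hne hv).1 (h _ ?_)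
      rcases undirectedComp_isMixed hu hne with ⟨-, h'⟩ | ⟨-, h'⟩
      · exact Or.inl h'
      · exact Or.inr (Or.inl h')
  · rintro h H (hH | hH | hH)
    · obtain ⟨u, hu⟩ := hH.1.1.2.1
      have huG : u ∈ G.verts := hH.1.1.1.1 hu
      have heq := hH.1.eq_undirectedComp hu
      rw [heq]
      refine (hasAPProperty_undirectedComp_iff (b := false) huG fun v w hv hadj => ?_).2 (h _ huG)
      refine hH.2 v ?_ w (assoc_adj_arc.1 hadj)
      rw [heq]
      exact (mem_undirectedComp huG).2 hv
    · obtain ⟨u, hu⟩ := hH.1.1.2.1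
      have huG : u ∈ G.verts := hH.1.1.1.1 hu
      have heq := hH.1.eq_undirectedComp hu
      rw [heq]
      refine (hasAPProperty_undirectedComp_iff (b := true) huG fun v w hv hadj => ?_).2 (h _ huG)
      refine hH.2 v ?_ w (assoc_adj_arc.1 hadj.symm)
      rw [heq]
      exact (mem_undirectedComp huG).2 hv
    · obtain ⟨x, hx, hne, rfl⟩ := hH.exists_eq_comp
      exact (hasAPProperty_comp_iff hx hne).2 (h x hx)

end SimpleMixedGraph

/-! ### The integrated matrix as a signless Laplacian, and Hamiltonian cycles -/

namespace SimpleMixedGraph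

variable {V : Type*} (G : SimpleMixedGraph V)

/-- The copy of a vertex of `G` in `V × Bool` that a row of the integrated matrices stands for. -/
def copy : G.verts ⊕ G.verts → V × Bool := Sum.elim (fun v => (v.1, false)) (fun v => (v.1, true))

theorem copy_injective : Function.Injective G.copy := by
  rintro (u | u) (v | v) h <;> simp_all [copy, Subtype.ext_iff]

theorem copy_mem (u : G.verts ⊕ G.verts) : (G.copy u).1 ∈ G.verts := by
  rcases u with u | u <;> exact u.2

theorem exists_copy_eq {x : V × Bool} (hx : x.1 ∈ G.verts) : ∃ u, G.copy u = x := by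
  rcases x with ⟨v, _ | _⟩
  · exact ⟨Sum.inl ⟨v, hx⟩, rfl⟩
  · exact ⟨Sum.inr ⟨v, hx⟩, rfl⟩

/-- The associated graph on the index type of the integrated matrices. -/
def assocOn : SimpleGraph (G.verts ⊕ G.verts) := G.assoc.comap G.copy

/-- The graph `assoc` lives on all of `V × Bool`, but pairs over vertices outside `G` are isolated,
so restricting to the finite index type loses no walk. -/
theorem assocOn_reachable {u v : G.verts ⊕ G.verts} :
    G.assocOn.Reachable u v ↔ G.assoc.Reachable (G.copy u) (G.copy v) := by
  constructor
  · intro h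
    exact h.map (SimpleGraph.Hom.comap G.copy G.assoc)
  · intro h
    have := SimpleGraph.reachable_mem_of_closed
      (C := {y | ∃ w, G.copy w = y ∧ G.assocOn.Reachable u w}) ?_ h ⟨u, rfl, .refl _⟩
    · obtain ⟨w, hw, hr⟩ := this
      rwa [← G.copy_injective hw]
    · rintro _ ⟨w, rfl, hr⟩ y hy
      obtain ⟨z, rfl⟩ := G.exists_copy_eq (assoc_adj_mem hy).2
      exact ⟨z, rfl, hr.trans (SimpleGraph.Adj.reachable hy)⟩

theorem degree_eq_ncard (v : V) : G.degree v = {w | s(v, w) ∈ G.edges}.ncard := by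
  have : {e | e ∈ G.edges ∧ v ∈ e} = (fun w => s(v, w)) '' {w | s(v, w) ∈ G.edges} := by
    ext e
    constructor
    · rintro ⟨he, hv⟩
      obtain ⟨w, rfl⟩ := Sym2.mem_iff_exists.1 hv
      exact ⟨w, he, rfl⟩
    · rintro ⟨w, hw, rfl⟩
      exact ⟨hw, by simp⟩
  rw [degree, this, Set.ncard_image_of_injective]
  intro a b h
  exact Sym2.congr_right.1 h

variable [Fintype G.verts]

open Classical in
theorem ncard_neighborSet_copy (u : G.verts ⊕ G.verts) :
    (G.assoc.neighborSet (G.copy u)).ncard = G.assocOn.degree u := by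
  have : G.assoc.neighborSet (G.copy u) = G.copy '' (G.assocOn.neighborSet u) := by
    ext y
    constructor
    · intro hy
      obtain ⟨z, rfl⟩ := G.exists_copy_eq (assoc_adj_mem hy).2
      exact ⟨z, hy, rfl⟩
    · rintro ⟨z, hz, rfl⟩
      exact hz
  rw [this, Set.ncard_image_of_injective _ G.copy_injective,
    ← SimpleGraph.card_neighborFinset_eq_degree, ← Set.ncard_coe_finset,
    SimpleGraph.coe_neighborFinset]

theorem finite_edge_neighbors (v : V) : {w | s(v, w) ∈ G.edges}.Finite :=
  (Set.toFinite G.verts).subset fun _ hw => G.edge_mem _ hw _ (by simp)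

theorem ncard_neighborSet_false (v : V) :
    (G.assoc.neighborSet (v, false)).ncard = G.degree v + G.outDegree v := by
  have : G.assoc.neighborSet (v, false) = (fun w => (w, false)) '' {w | s(v, w) ∈ G.edges} ∪
      (fun w => (w, true)) '' {w | (v, w) ∈ G.arcs} := by
    ext ⟨w, _ | _⟩ <;> simp [assoc_adj]
  rw [this, Set.ncard_union_eq ?_ ?_ ?_, Set.ncard_image_of_injective _ (Prod.mk_left_injective _),
    Set.ncard_image_of_injective _ (Prod.mk_left_injective _), degree_eq_ncard, outDegree]
  · rw [Set.disjoint_left]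
    rintro _ ⟨w, -, rfl⟩ ⟨z, -, h⟩
    simp at h
  · exact (G.finite_edge_neighbors v).image _
  · exact ((Set.toFinite G.verts).subset fun w hw => (G.arc_mem _ hw).2).image _

theorem ncard_neighborSet_true (v : V) :
    (G.assoc.neighborSet (v, true)).ncard = G.degree v + G.inDegree v := by
  have : G.assoc.neighborSet (v, true) = (fun w => (w, true)) '' {w | s(v, w) ∈ G.edges} ∪
      (fun w => (w, false)) '' {w | (w, v) ∈ G.arcs} := by
    ext ⟨w, _ | _⟩ <;> simp [assoc_adj]
  rw [this, Set.ncard_union_eq ?_ ?_ ?_, Set.ncard_image_of_injective _ (Prod.mk_left_injective _),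
    Set.ncard_image_of_injective _ (Prod.mk_left_injective _), degree_eq_ncard, inDegree]
  · rw [Set.disjoint_left]
    rintro _ ⟨w, -, rfl⟩ ⟨z, -, h⟩
    simp at h
  · exact (G.finite_edge_neighbors v).image _
  · exact ((Set.toFinite G.verts).subset fun w hw => (G.arc_mem _ hw).1).image _

open Classical in
theorem signlessLaplacian_eq : G.signlessLaplacian =
    Matrix.diagonal (fun u => (G.assocOn.degree u : ℝ)) + G.assocOn.adjMatrix ℝ := by
  unfold signlessLaplacian
  congr 1
  · unfold integratedDegree
    congr 1
    funext u
    rw [← ncard_neighborSet_copy]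
    rcases u with v | v
    · simp only [Sum.elim_inl, copy, ncard_neighborSet_false]
    · simp only [Sum.elim_inr, copy, ncard_neighborSet_true]
  · ext u v
    rw [SimpleGraph.adjMatrix_apply]
    rcases u with u | u <;> rcases v with v | v <;>
      simp [integratedAdjacency, edgeMatrix, arcMatrix, assocOn, copy, assoc_adj]

theorem isTopSignless_xiOne [Nonempty G.verts] : G.assocOn.IsTopSignless G.xiOne := by
  classical
  exact SimpleGraph.isTopSignless_eigenvalues₀ G.assocOn G.signlessLaplacian_isHermitian
    (by rw [signlessLaplacian_eq]; congr!) _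

theorem finite_reachable {x : V × Bool} (hx : x.1 ∈ G.verts) :
    {y | G.assoc.Reachable x y}.Finite :=
  ((Set.toFinite G.verts).prod (Set.toFinite (Set.univ : Set Bool))).subset
    fun _ hy => ⟨assoc_reachable_mem hy hx, Set.mem_univ _⟩

variable {G}

theorem xiOne_eq_zero_iff [Nonempty G.verts] : G.xiOne = 0 ↔ G.edges = ∅ ∧ G.arcs = ∅ := by
  rw [G.isTopSignless_xiOne.eq_zero_iff]
  constructor
  · intro h
    have hno : ∀ x y, ¬ G.assoc.Adj x y := fun x y hxy => by
      obtain ⟨u, rfl⟩ := G.exists_copy_eq (assoc_adj_mem hxy).1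
      obtain ⟨v, rfl⟩ := G.exists_copy_eq (assoc_adj_mem hxy).2
      exact h u v hxy
    refine ⟨Set.eq_empty_of_forall_notMem fun e he => ?_,
      Set.eq_empty_of_forall_notMem fun a ha => hno _ _ (assoc_adj_arc.2 ha)⟩
    induction e with | _ u v
    exact hno _ _ ((assoc_adj_same (b := false)).2 he)
  · rintro ⟨h1, h2⟩ u v h
    have : G.assoc.Adj (G.copy u) (G.copy v) := h
    simp [assoc_adj, h1, h2] at this

theorem xiOne_lt_four_iff [Nonempty G.verts] : G.xiOne < 4 ↔ ∀ x : V × Bool, x.1 ∈ G.verts →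
    ∃ m p, G.assoc.IsPathEnum {y | G.assoc.Reachable x y} m p := by
  classical
  rw [G.isTopSignless_xiOne.lt_four_iff]
  constructor
  · rintro ⟨h2, h1⟩ x hx
    rw [SimpleGraph.exists_isPathEnum_iff x (G.finite_reachable hx)]
    constructor
    · intro y hy
      obtain ⟨u, rfl⟩ := G.exists_copy_eq (assoc_reachable_mem hy hx)
      rw [ncard_neighborSet_copy]
      convert h2 u
    · obtain ⟨u, rfl⟩ := G.exists_copy_eq hx
      obtain ⟨v, hv, hd⟩ := h1 u
      refine ⟨G.copy v, G.assocOn_reachable.1 hv, ?_⟩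
      rw [ncard_neighborSet_copy]
      convert hd
  · intro h
    have h' : ∀ u, _ := fun u =>
      (SimpleGraph.exists_isPathEnum_iff _ (G.finite_reachable (G.copy_mem u))).1
        (h _ (G.copy_mem u))
    constructor
    · intro u
      have := (h' u).1 _ (.refl _)
      rw [ncard_neighborSet_copy] at this
      convert this
    · intro u
      obtain ⟨y, hy, hd⟩ := (h' u).2
      obtain ⟨v, rfl⟩ := G.exists_copy_eq (assoc_reachable_mem hy (G.copy_mem u))
      refine ⟨v, G.assocOn_reachable.2 hy, ?_⟩
      rw [ncard_neighborSet_copy] at hd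
      convert hd

theorem xiOne_eq_four_iff [Nonempty G.verts] (hconn : ∀ x y : V × Bool, x.1 ∈ G.verts →
    y.1 ∈ G.verts → G.assoc.Reachable x y) :
    G.xiOne = 4 ↔ ∀ x : V × Bool, x.1 ∈ G.verts → (G.assoc.neighborSet x).ncard = 2 := by
  classical
  rw [G.isTopSignless_xiOne.eq_four_iff
    (fun u v => G.assocOn_reachable.2 (hconn _ _ (G.copy_mem u) (G.copy_mem v)))]
  · constructor
    · intro h x hx
      obtain ⟨u, rfl⟩ := G.exists_copy_eq hx
      rw [ncard_neighborSet_copy]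
      convert h u
    · intro h u
      have := h _ (G.copy_mem u)
      rw [ncard_neighborSet_copy] at this
      convert this
  -- No vertex is adjacent to all the others: the two copies of `v` could be joined only by a
  -- directed loop.
  · rintro (v | v)
    · exact ⟨Sum.inr v, by simp, fun h => G.arc_loopless _ (assoc_adj_arc.1 h) rfl⟩
    · exact ⟨Sum.inl v, by simp, fun h => G.arc_loopless _ (assoc_adj_arc.1 h.symm) rfl⟩

theorem card_copies : Fintype.card (G.verts ⊕ G.verts) = 2 * Fintype.card G.verts := by
  rw [Fintype.card_sum, two_mul]

/-- The associated graph is a single cycle through all `2n` copies. Its projection has an even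
number of arcs because the lift returns to the copy at which it started. -/
theorem exists_cycle_of_regular [Nonempty G.verts]
    (hconn : ∀ x y : V × Bool, x.1 ∈ G.verts → y.1 ∈ G.verts → G.assoc.Reachable x y)
    (hreg : ∀ x : V × Bool, x.1 ∈ G.verts → (G.assoc.neighborSet x).ncard = 2) :
    ∃ W : G.Walk, W.IsAlternatingCycle ∧ W.length = 2 * Fintype.card G.verts ∧
      Even W.arcCount ∧ (∀ v ∈ G.verts, 1 ≤ W.vertCount v) ∧
      (∀ a ∈ G.arcs, 1 ≤ W.arcOccurrences a) ∧ (∀ e ∈ G.edges, W.edgeCount e = 2) := by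
  obtain ⟨v₀, hv₀⟩ : G.verts.Nonempty := Set.nonempty_coe_sort.1 inferInstance
  obtain ⟨m, p, hm, hp0, hinj, hmem, hadj⟩ := SimpleGraph.exists_cycle_enum (K := G.assoc)
    (v₀, false) (G.finite_reachable hv₀) (fun y hy => hreg y (assoc_reachable_mem hy hv₀))
  have hcov : ∀ y : V × Bool, y.1 ∈ G.verts → ∃ i ≤ m, p i = y := fun y hy =>
    (hmem y).1 (hconn _ _ hv₀ hy)
  have hpv : ∀ i ≤ m, (p i).1 ∈ G.verts := fun i hi =>
    assoc_reachable_mem ((hmem _).2 ⟨i, hi, rfl⟩) hv₀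
  -- The enumeration of the `m + 1` vertices is closed up by returning to `p 0` at index `m + 1`.
  let q : ℕ → V × Bool := fun i => if i ≤ m then p i else p 0
  have hq : ∀ i ≤ m, q i = p i := fun i hi => by simp [q, hi]
  have hq1 : q (m + 1) = p 0 := by simp [q]
  have hqadj : ∀ i < m + 1, G.assoc.Adj (q i) (q (i + 1)) := by
    intro i hi
    rcases (show i < m ∨ i = m by omega) with h | rfl
    · rw [hq i (by omega), hq (i + 1) (by omega), hadj i (by omega) _ (by omega)]
      exact Or.inl rfl
    · rw [hq i le_rfl, hq1, hadj i le_rfl 0 (by omega)]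
      exact Or.inr (Or.inr (Or.inr ⟨rfl, rfl⟩))
  obtain ⟨W, hlen, hL⟩ : ∃ W : G.Walk, W.length = m + 1 ∧ W.IsLift q :=
    ⟨Walk.ofSeq (m + 1) q hqadj (by rw [hq 0 (by omega)]; exact hpv 0 (by omega)), rfl,
      Walk.isLift_ofSeq _ _ _ _⟩
  have hne : G.arcs.Nonempty := by
    rcases reachable_cases (hconn (v₀, false) (v₀, true) hv₀ hv₀) with ⟨h, -⟩ | ⟨v, w, -, h⟩
    · simp at h
    · exact ⟨_, assoc_adj_arc.1 h⟩
  -- Here `2 ≤ m` matters: on two vertices the closing step would repeat the first edge.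
  have htr : ∀ i < W.length, ∀ j < W.length, s(q i, q (i + 1)) = s(q j, q (j + 1)) → i = j := by
    have hval : ∀ i < m + 1, q (i + 1) = p (if i = m then 0 else i + 1) := fun i hi => by
      split_ifs with h
      · rw [h, hq1]
      · exact hq _ (by omega)
    intro i hi j hj he
    rw [hlen] at hi hj
    rw [hq i (by omega), hq j (by omega), hval i hi, hval j hj] at he
    rcases Sym2.eq_iff.1 he with ⟨h1, -⟩ | ⟨h1, h2⟩
    · exact hinj _ (by omega) _ (by omega) h1
    · have h1 := hinj _ (by omega) _ (by split_ifs <;> omega) h1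
      have h2 := hinj _ (by split_ifs <;> omega) _ (by omega) h2
      split_ifs at h1 h2 <;> omega
  have hstep : ∀ x y, G.assoc.Adj x y → ∃ i < W.length, s(q i, q (i + 1)) = s(x, y) := by
    intro x y hxy
    obtain ⟨i, hi, rfl⟩ := hcov x (assoc_adj_mem hxy).1
    obtain ⟨j, hj, rfl⟩ := hcov y (assoc_adj_mem hxy).2
    rw [hlen]
    rcases (hadj i hi j hj).1 hxy with rfl | rfl | ⟨rfl, rfl⟩ | ⟨rfl, rfl⟩
    · exact ⟨i, by omega, by rw [hq i hi, hq _ hj]⟩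
    · exact ⟨j, by omega, by rw [hq j hj, hq _ hi, Sym2.eq_swap]⟩
    · exact ⟨j, by omega, by rw [hq j hj, hq1, Sym2.eq_swap]⟩
    · exact ⟨i, by omega, by rw [hq i hi, hq1]⟩
  have hends : q 0 = q W.length := by rw [hlen, hq1, hq 0 (by omega)]
  have hcond := hL.edgeCondition_and_arcCondition_iff.2 htr
  refine ⟨W, ⟨hL.isAlternating hne, hcond.1, hcond.2, ?_⟩, ?_, ?_, ?_, ?_, ?_⟩
  · rw [hL.start_eq, hL.finish_eq, hends]
  · rw [hlen, ← card_copies, ← Fintype.card_fin (m + 1)]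
    refine Fintype.card_of_bijective (f := fun i : Fin (m + 1) =>
      (G.exists_copy_eq (hpv i (Nat.lt_succ_iff.1 i.2))).choose) ⟨fun i j hij => ?_, fun u => ?_⟩
    · have hi := (G.exists_copy_eq (hpv i (Nat.lt_succ_iff.1 i.2))).choose_spec
      have hj := (G.exists_copy_eq (hpv j (Nat.lt_succ_iff.1 j.2))).choose_spec
      simp only at hij
      rw [hij, hj] at hi
      exact Fin.ext (hinj _ (Nat.lt_succ_iff.1 i.2) _ (Nat.lt_succ_iff.1 j.2) hi.symm)
    · obtain ⟨i, hi, he⟩ := hcov _ (G.copy_mem u)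
      refine ⟨⟨i, by omega⟩, G.copy_injective ?_⟩
      rw [← he]
      exact (G.exists_copy_eq (hpv i hi)).choose_spec
  · rw [← Nat.not_odd_iff_even, hL.odd_arcCount_iff, hends]
    simp
  · intro v hv
    obtain ⟨i, hi, he⟩ := hcov (v, false) hv
    rw [Nat.one_le_iff_ne_zero, ← Nat.pos_iff_ne_zero, Walk.vertCount, Set.ncard_pos]
    refine ⟨⟨i, by omega⟩, ?_⟩
    rw [Set.mem_ofPred_eq, ← hL.1, hq i hi, he]
  · intro a ha
    rw [hL.arcOccurrences_pos_iff]
    exact hstep _ _ (assoc_adj_arc.2 ha)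
  · intro e he
    induction e with | _ u v
    rw [hL.edgeCount_eq htr, Set.ncard_bool_eq_two_iff]
    exact fun b => hstep _ _ (assoc_adj_same.2 he)

/-- An even number of arcs makes the lift a closed trail, and the counts make it traverse every edge
of `assoc`. It visits all `2n` vertices in `2n` steps, hence each once, so the neighbours of a
vertex are its predecessor and its successor. -/
theorem regular_of_cycle (hconn : ∀ x y : V × Bool, x.1 ∈ G.verts → y.1 ∈ G.verts →
    G.assoc.Reachable x y) {W : G.Walk} (hW : W.IsAlternatingCycle)
    (hlen : W.length = 2 * Fintype.card G.verts) (heven : Even W.arcCount)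
    (harc : ∀ a ∈ G.arcs, 1 ≤ W.arcOccurrences a) (hedge : ∀ e ∈ G.edges, W.edgeCount e = 2)
    {x : V × Bool} (hx : x.1 ∈ G.verts) : (G.assoc.neighborSet x).ncard = 2 := by
  obtain ⟨q, hq⟩ := hW.1.exists_isLift
  have htr := hq.edgeCondition_and_arcCondition_iff.1 ⟨hW.2.1, hW.2.2.1⟩
  have hends : q W.length = q 0 := by
    rw [← Nat.not_odd_iff_even, hq.odd_arcCount_iff, not_not] at heven
    have := hW.2.2.2
    rw [hq.start_eq, hq.finish_eq] at this
    exact (Prod.ext this heven).symm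
  have hstep : ∀ x y, G.assoc.Adj x y → ∃ i < W.length, s(q i, q (i + 1)) = s(x, y) := by
    rintro ⟨u, b⟩ ⟨v, c⟩ hxy
    by_cases hbc : b = c
    · subst hbc
      have := hedge _ (assoc_adj_same.1 hxy)
      rw [hq.edgeCount_eq htr, Set.ncard_bool_eq_two_iff] at this
      exact this b
    · cases b <;> cases c
      · exact absurd rfl hbc
      · exact (hq.arcOccurrences_pos_iff _).1 (harc _ (assoc_adj_arc.1 hxy))
      · rw [Sym2.eq_swap]
        exact (hq.arcOccurrences_pos_iff _).1 (harc _ (assoc_adj_arc.1 hxy.symm))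
      · exact absurd rfl hbc
  have hpos : 0 < W.length := by
    rw [hlen]
    have : Nonempty G.verts := ⟨⟨_, hx⟩⟩
    have := Fintype.card_pos (α := G.verts)
    omega
  -- the walk visits every vertex of the associated graph, hence each exactly once
  have hcov : ∀ y : V × Bool, y.1 ∈ G.verts → ∃ i < W.length, q i = y := by
    rintro ⟨v, b⟩ hv
    -- A copy of `v` is not isolated, since it is joined to the other copy; an edge at it is
    -- traversed, so it is visited.
    obtain ⟨z, hz⟩ : ∃ z, G.assoc.Adj (v, b) z := by
      obtain ⟨w⟩ := hconn (v, b) (v, !b) hv hv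
      have hne : (v, b) ≠ (v, !b) := by simp
      exact ⟨_, w.adj_snd (SimpleGraph.Walk.not_nil_of_ne hne)⟩
    obtain ⟨i, hi, he⟩ := hstep _ _ hz
    rcases Sym2.eq_iff.1 he with ⟨h, -⟩ | ⟨-, h⟩
    · exact ⟨i, hi, h⟩
    · rcases Nat.lt_or_ge (i + 1) W.length with h' | h'
      · exact ⟨i + 1, h', h⟩
      · have : i + 1 = W.length := by omega
        rw [this, hends] at h
        exact ⟨0, hpos, h⟩
  have hqv : ∀ i ≤ W.length, (q i).1 ∈ G.verts := fun i hi => by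
    have := W.vert_mem ⟨i, by omega⟩
    rwa [← hq.1] at this
  have hinj : ∀ i < W.length, ∀ j < W.length, q i = q j → i = j := by
    let f : Fin W.length → G.verts ⊕ G.verts := fun i => (G.exists_copy_eq (hqv i i.2.le)).choose
    have hf : ∀ i, G.copy (f i) = q i := fun i => (G.exists_copy_eq (hqv i i.2.le)).choose_spec
    have hsurj : Function.Surjective f := fun u => by
      obtain ⟨i, hi, he⟩ := hcov _ (G.copy_mem u)
      exact ⟨⟨i, hi⟩, G.copy_injective (by rw [hf, he])⟩
    have hbij := (Fintype.bijective_iff_surjective_and_card f).2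
      ⟨hsurj, by rw [Fintype.card_fin, card_copies, hlen]⟩
    intro i hi j hj he
    have : f ⟨i, hi⟩ = f ⟨j, hj⟩ := G.copy_injective (by rw [hf, hf, he])
    exact congrArg Fin.val (hbij.1 this)
  obtain ⟨i, hi, rfl⟩ := hcov x hx
  -- the predecessor of the vertex on the closed walk
  obtain ⟨k, hk, hki, hsucc⟩ : ∃ k < W.length, q (k + 1) = q i ∧
      ∀ l < W.length, q (l + 1) = q i → l = k := by
    rcases Nat.eq_zero_or_pos i with rfl | h
    · refine ⟨W.length - 1, by omega, by rw [Nat.sub_add_cancel hpos, hends], fun l hl he => ?_⟩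
      by_contra hne
      have := hinj _ (by omega) _ hpos he
      omega
    · refine ⟨i - 1, by omega, by rw [Nat.sub_add_cancel h], fun l hl he => ?_⟩
      rcases Nat.lt_or_ge (l + 1) W.length with h' | h'
      · have := hinj _ h' _ hi he
        omega
      · have h'' : l + 1 = W.length := by omega
        rw [h'', hends] at he
        have := hinj _ hpos _ hi he
        omega
  have hset : G.assoc.neighborSet (q i) = {q k, q (i + 1)} := by
    ext y
    simp only [SimpleGraph.mem_neighborSet, Set.mem_insert_iff, Set.mem_singleton_iff]
    constructor
    · intro hy
      obtain ⟨l, hl, he⟩ := hstep _ _ hy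
      rcases Sym2.eq_iff.1 he with ⟨h1, h2⟩ | ⟨h1, h2⟩
      · obtain rfl := hinj _ hl _ hi h1
        exact Or.inr h2.symm
      · obtain rfl := hsucc l hl h2
        exact Or.inl h1.symm
    · rintro (rfl | rfl)
      · have := hq.adj hk
        rw [hki] at this
        exact this.symm
      · exact hq.adj hi
  rw [hset, Set.ncard_pair]
  intro he
  -- If predecessor and successor coincided, steps `k` and `i` would use the same edge, so `k = i`
  -- in a trail and the vertex would be adjacent to itself.
  have h1 := htr k hk i hi (by rw [hki, he, Sym2.eq_swap])
  subst h1
  exact (hq.adj hi).ne hki.symm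

end SimpleMixedGraph

theorem mainTheorem8 {V : Type*} (G : SimpleMixedGraph V) [Fintype G.verts] [Nonempty G.verts] :
    (G.xiOne = 0 ↔ G.edges = ∅ ∧ G.arcs = ∅) ∧
    (G.xiOne < 4 ↔ ∀ H : SimpleMixedGraph V, H.IsMixedComponent G → H.HasAPProperty) ∧
    (G.Uniconnected →
      (G.xiOne = 4 ↔
        ∃ W : G.Walk, W.IsAlternatingCycle ∧ W.length = 2 * Fintype.card G.verts ∧
          Even W.arcCount ∧
          (∀ v ∈ G.verts, 1 ≤ W.vertCount v) ∧
          (∀ a ∈ G.arcs, 1 ≤ W.arcOccurrences a) ∧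
          (∀ e ∈ G.edges, W.edgeCount e = 2))) := by
  refine ⟨SimpleMixedGraph.xiOne_eq_zero_iff, ?_, fun hG => ?_⟩
  · rw [SimpleMixedGraph.xiOne_lt_four_iff, SimpleMixedGraph.forall_hasAPProperty_iff]
  · have hconn : ∀ x y : V × Bool, x.1 ∈ G.verts → y.1 ∈ G.verts → G.assoc.Reachable x y :=
      fun x y hx hy => hG.reachable hx hy
    rw [SimpleMixedGraph.xiOne_eq_four_iff hconn]
    constructor
    · exact SimpleMixedGraph.exists_cycle_of_regular hconn
    · rintro ⟨W, hW, hlen, heven, -, harc, hedge⟩ x hx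
      exact SimpleMixedGraph.regular_of_cycle hconn hW hlen heven harc hedge hx
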